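/- Let $m\ge 1$, let $\mathcal P_n$ be the space of holomorphic polynomials on $\mathbb C^m$ of degree at most $n$, and put $d_n=\dim\mathcal P_n=\binom{m+n}{n}$. Let $K\subset\mathbb C^m$ be a locally regular compact set (for every $z\in K$ and all sufficiently small $r>0$, the pluricomplex Green function of $K\cap\overline{B(z,r)}$ is continuous at $z$) and let $q$ be a continuous real-valued function on $K$. For every $n\ge1$ let $p_{n1},\dots,p_{nd_n}$ be a basis of $\mathcal P_n$ with $\sup_{K}|p_{nj}|e^{-nq}\le 1$ for all $j$, and let $\mu_n$ be a Borel probability measure on $\mathbb C^{d_n}$ that puts no mass on pluripolar sets. Suppose that there are a constant $\alpha\ge2$ and constants $D_n>0$ with $D_n=o(n^\alpha)$ such that for every $n\ge 1$ and every $v\in\mathbb C^{d_n}$ with $\|v\|=1$ $$\int_{\mathbb C^{d_n}}\Bigl|\log\Bigl|\sum_{j=1}^{d_n}a_jv_j\Bigr|\Bigr|^{\alpha}\,d\mu_n(a)\le D_n .$$ Consider the random polynomials $f_n=\sum_{j=1}^{d_n}a_j\,p_{nj}$, where $a\in\mathbb C^{d_n}$ has law $\mu_n$. For a polynomial $f$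 with zero set $Z_f\subset\mathbb C^m$ and a real-valued test form $\varphi$ (smooth, compactly supported) of bidegree $(m-1,m-1)$ on $\mathbb C^m$, let $\langle[Z_f],\varphi\rangle=\int_{\mathrm{Reg}\,Z_f}\varphi$, where $\mathrm{Reg}\,Z_f$ is the set of points near which $Z_f$ is a complex submanifold of dimension $m-1$. Then for every such $\varphi$ there is a constant $C_\varphi\ge 0$, depending only on $\varphi$ (in particular not on $K$, $q$, the bases, the measures, $\alpha$, $(D_n)$ or $n$), such that for every $n\ge1$ the random variable $\langle\frac1n[Z_{f_n}],\varphi\rangle$ is square-integrable and $$\mathrm{Var}\Bigl\langle \tfrac1n[Z_{f_n}],\varphi\Bigr\rangle=\mathbb E\Bigl\langle \tfrac1n[Z_{f_n}],\varphi\Bigr\rangle^2-\Bigl(\mathbb E\Bigl\langle \tfrac1n[Z_{f_n}],\varphi\Bigr\rangle\Bigr)^2\le C_\varphi^2\,D_n^{2/\alpha}\,\frac1{n^2}.$$ -/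

import Mathlib

open scoped ContDiff

noncomputable section

namespace RandomZeros

/-! ### Plurisubharmonic functions and pluripolar sets -/

section Pluripotential

variable {E : Type*} [NormedAddCommGroup E] [NormedSpace ℂ E]

/-- `u` is plurisubharmonic on the open set `U` (the value `-∞ = ⊥` is allowed, also identically):
`u` is upper semicontinuous, `u < +∞`, and `u` satisfies the sub-mean value inequality
`u a ≤ (2π)⁻¹ ∫ u (a + e^{iθ} b) dθ` on every closed complex disc contained in `U`.  As `u` is upper
semicontinuous, its mean over the circle (possibly `-∞`) is the infimum of the means of the
continuous real functions `h` that dominate `u` on the circle; the inequality is stated in this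
form. -/
def IsPSHOn (u : E → EReal) (U : Set E) : Prop :=
  UpperSemicontinuousOn u U ∧ (∀ z ∈ U, u z < ⊤) ∧
    ∀ a b : E, (∀ ζ : ℂ, ‖ζ‖ ≤ 1 → a + ζ • b ∈ U) →
      ∀ h : ℂ → ℝ, Continuous h → (∀ ζ : ℂ, ‖ζ‖ = 1 → u (a + ζ • b) ≤ (h ζ : EReal)) →
        u a ≤ ((Real.circleAverage h 0 1 : ℝ) : EReal)

/-- `F` is (locally) pluripolar: near each of its points, `F` lies in the `-∞` locus of a
plurisubharmonic function that is not identically `-∞`. -/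
def IsPluripolar (F : Set E) : Prop :=
  ∀ z₀ ∈ F, ∃ U : Set E, IsOpen U ∧ IsConnected U ∧ z₀ ∈ U ∧
    ∃ ψ : E → EReal, IsPSHOn ψ U ∧ (∃ z ∈ U, ψ z ≠ ⊥) ∧ ∀ z ∈ F ∩ U, ψ z = ⊥

end Pluripotential

/-! ### The pluricomplex Green function and locally regular sets -/

/-- The Lelong class of `ℂ^m`: plurisubharmonic functions `u` with `u(ζ) - log |ζ|` bounded above
near infinity.  (The choice of the norm does not matter here.) -/
def lelongClass (m : ℕ) : Set ((Fin m → ℂ) → EReal) :=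
  {u | IsPSHOn u Set.univ ∧
    ∃ C R : ℝ, 0 < R ∧ ∀ ζ : Fin m → ℂ, R ≤ ‖ζ‖ → u ζ ≤ ((C + Real.log ‖ζ‖ : ℝ) : EReal)}

/-- The pluricomplex Green function `V_K`. -/
def greenFunction {m : ℕ} (K : Set (Fin m → ℂ)) (z : Fin m → ℂ) : EReal :=
  sSup {x : EReal | ∃ u ∈ lelongClass m, (∀ w ∈ K, u w ≤ 0) ∧ x = u z}

/-- The closed Euclidean ball of `ℂ^m`. -/
def closedEuclideanBall {m : ℕ} (z : Fin m → ℂ) (r : ℝ) : Set (Fin m → ℂ) :=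
  {w | ∑ i, ‖w i - z i‖ ^ 2 ≤ r ^ 2}

/-- `K` is locally regular: for every `z ∈ K` the Green function of `K ∩ B̄(z, r)` is continuous at
`z` for all sufficiently small `r > 0`. -/
def IsLocallyRegular {m : ℕ} (K : Set (Fin m → ℂ)) : Prop :=
  ∀ z ∈ K, ∃ r₀ : ℝ, 0 < r₀ ∧ ∀ r : ℝ, 0 < r → r ≤ r₀ →
    ContinuousAt (greenFunction (K ∩ closedEuclideanBall z r)) z

/-! ### Test forms of bidegree `(m-1, m-1)` -/

/-- Real test forms of bidegree `(m-1, m-1)` on `ℂ^m`: smooth compactly supported real differential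
forms of degree `2(m-1)`.  A form of type `(r, s)` is multiplied by `c^r * conj c^s` when all
arguments are multiplied by `c ∈ ℂ`; hence a form of degree `2(m-1)` has pure type `(m-1, m-1)` if
and only if it is invariant under the multiplication of all arguments by any `c` with `|c| = 1`. -/
structure TestForm (m : ℕ) where
  /-- the underlying differential form -/
  toFun : (Fin m → ℂ) → (Fin m → ℂ) [⋀^Fin ((m - 1) * 2)]→L[ℝ] ℝ
  smooth : ContDiff ℝ ∞ toFun
  compactSupport : HasCompactSupport toFun
  bidegree : ∀ (z : Fin m → ℂ) (c : ℂ), ‖c‖ = 1 →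
    ∀ v : Fin ((m - 1) * 2) → Fin m → ℂ, toFun z (fun i => c • v i) = toFun z v

/-! ### Integration over complex submanifolds -/

/-- `ψ : W → ℂ^m` is a local holomorphic parametrization of `Z ⊆ ℂ^m` by an open set `W ⊆ ℂ^k`:
a holomorphic immersion that is a homeomorphism of `W` onto a relatively open subset of `Z`. -/
def IsLocalParam {m k : ℕ} (Z : Set (Fin m → ℂ)) (W : Set (Fin k → ℂ))
    (ψ : (Fin k → ℂ) → Fin m → ℂ) : Prop :=
  IsOpen W ∧ DifferentiableOn ℂ ψ W ∧ (∀ w ∈ W, Function.Injective (fderiv ℂ ψ w)) ∧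
    Topology.IsEmbedding (W.domRestrict ψ) ∧ ∃ U : Set (Fin m → ℂ), IsOpen U ∧ ψ '' W = Z ∩ U

/-- The regular points of a hypersurface `Z ⊆ ℂ^m`: the points near which `Z` is a complex
submanifold of dimension `m - 1`. -/
def regularPoints {m : ℕ} (Z : Set (Fin m → ℂ)) : Set (Fin m → ℂ) :=
  {z | ∃ (W : Set (Fin (m - 1) → ℂ)) (ψ : (Fin (m - 1) → ℂ) → Fin m → ℂ),
    IsLocalParam Z W ψ ∧ z ∈ ψ '' W}

/-- The real frame `e₁, i e₁, e₂, i e₂, …` of `ℂ^k`, which is positive for the orientation given by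
the complex structure and spans a box of Lebesgue measure one. -/
def complexFrame (k : ℕ) (j : Fin (k * 2)) : Fin k → ℂ :=
  Pi.single (finProdFinEquiv.symm j).1 (if (finProdFinEquiv.symm j).2 = 0 then 1 else Complex.I)

/-- The density, with respect to Lebesgue measure on `ℂ^(m-1)`, of the pull-back of the form `φ`
by the holomorphic map `ψ`. -/
def pullbackDensity {m : ℕ} (φ : TestForm m) (ψ : (Fin (m - 1) → ℂ) → Fin m → ℂ)
    (w : Fin (m - 1) → ℂ) : ℝ :=
  φ.toFun (ψ w) (fun j => fderiv ℂ ψ w (complexFrame (m - 1) j))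

/-- A decomposition of the `(m-1)`-dimensional complex manifold `M` into countably many disjoint
pieces `ψ i '' B i`, where `B i` is a Borel subset of the domain of the local parametrization
`ψ i`. -/
structure ChartDecomposition {m : ℕ} (M : Set (Fin m → ℂ)) where
  /-- the domains of the parametrizations -/
  W : ℕ → Set (Fin (m - 1) → ℂ)
  /-- the parametrizations -/
  ψ : ℕ → (Fin (m - 1) → ℂ) → Fin m → ℂ
  /-- the Borel pieces -/
  B : ℕ → Set (Fin (m - 1) → ℂ)
  isLocalParam : ∀ i, IsLocalParam M (W i) (ψ i)
  subset : ∀ i, B i ⊆ W i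
  measurable : ∀ i, MeasurableSet (B i)
  disjoint : Pairwise fun i j => Disjoint (ψ i '' B i) (ψ j '' B j)
  cover : ⋃ i, ψ i '' B i = M

open Classical in
/-- The integral `∫_M φ` of a test form of bidegree `(m-1, m-1)` over an `(m-1)`-dimensional complex
submanifold `M` of `ℂ^m` with its complex orientation, computed by means of a decomposition of `M`
into countably many pieces that lie in charts.  Whenever `φ` is absolutely integrable over `M`, the
value does not depend on the decomposition. -/
def integralOver {m : ℕ} (M : Set (Fin m → ℂ)) (φ : TestForm m) : ℝ :=
  if h : Nonempty (ChartDecomposition M) then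
    ∑' i, ∫ w in h.some.B i, pullbackDensity φ (h.some.ψ i) w
  else 0

/-! ### Zero currents of polynomials -/

/-- The zero set `Z_f` in `ℂ^m` of a polynomial `f`. -/
def zeroSet {m : ℕ} (f : MvPolynomial (Fin m) ℂ) : Set (Fin m → ℂ) :=
  {z | MvPolynomial.eval z f = 0}

/-- The current of integration over the zero set: `⟨[Z_f], φ⟩ = ∫_{Reg Z_f} φ`. -/
def zeroCurrent {m : ℕ} (f : MvPolynomial (Fin m) ℂ) (φ : TestForm m) : ℝ :=
  integralOver (regularPoints (zeroSet f)) φ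

/-! ### Random polynomials -/

/-- The space `𝒫_n` of polynomials of degree at most `n` on `ℂ^m`. -/
abbrev polySpace (m n : ℕ) : Submodule ℂ (MvPolynomial (Fin m) ℂ) :=
  MvPolynomial.restrictTotalDegree (Fin m) ℂ n

/-- `d_n = dim 𝒫_n`. -/
abbrev polyDim (m n : ℕ) : ℕ := (m + n).choose n

/-- The polynomial `∑ⱼ aⱼ pⱼ` with coefficients `a` in the basis `p` of `𝒫_n`. -/
def polyOf {m n : ℕ} (p : Module.Basis (Fin (polyDim m n)) ℂ (polySpace m n))
    (a : Fin (polyDim m n) → ℂ) : MvPolynomial (Fin m) ℂ :=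
  ∑ j, a j • (p j : MvPolynomial (Fin m) ℂ)

/-- The random variable `a ↦ ⟨(1/n) [Z_f], φ⟩` on `ℂ^{d_n} ≅ 𝒫_n`, where `f = ∑ⱼ aⱼ pⱼ`. -/
def normalizedZeroCurrent {m n : ℕ} (p : Module.Basis (Fin (polyDim m n)) ℂ (polySpace m n))
    (φ : TestForm m) (a : Fin (polyDim m n) → ℂ) : ℝ :=
  (1 / (n : ℝ)) * zeroCurrent (polyOf p a) φ

/-- `μ` satisfies the logarithmic moment condition with exponent `α` and bound `D`:
`∫ |log |⟨a, v⟩||^α dμ(a) ≤ D` for all unit vectors `v`.  (Used for measures without mass on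
pluripolar sets, for which the hyperplane `⟨a, v⟩ = 0` is a null set.) -/
def LogMomentBound {d : ℕ} (μ : MeasureTheory.Measure (Fin d → ℂ)) (α D : ℝ) : Prop :=
  ∀ v : Fin d → ℂ, ∑ j, ‖v j‖ ^ 2 = 1 →
    ∫⁻ a, ENNReal.ofReal (|Real.log ‖∑ j, a j * v j‖| ^ α) ∂μ ≤ ENNReal.ofReal D

/-- The variance `𝔼 X² - (𝔼 X)²`. -/
def variance {Ω : Type*} [MeasurableSpace Ω] (μ : MeasureTheory.Measure Ω) (X : Ω → ℝ) : ℝ :=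
  (∫ a, X a ^ 2 ∂μ) - (∫ a, X a ∂μ) ^ 2

end RandomZeros

end

/-!
The argument rests on the Poincaré–Lelong formula `⟨[Z_f], φ⟩ = ∫ log |f| G`, in which the
continuous compactly supported function `G` depends on the test form `φ` only.  Once it is known for
almost every random polynomial `f = ∑ aⱼ pⱼ`, write `log |f(z)| = log |⟨a, v(z)⟩| + log |p(z)|`,
where `|p(z)|` is the Euclidean norm of `(p₁(z), …, p_d(z))` and `v(z)` the corresponding unit
vector.  The second summand is not random, so the variance of `⟨[Z_f], φ⟩` is at most the second
moment of `∫ log |⟨a, v(z)⟩| G(z) dz`; by the Cauchy–Schwarz inequality, Tonelli's theorem and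
Jensen's inequality this is at most `‖G‖₁² D ^ (2 / α)`
(`lintegral_sq_integral_mul_le`, `LogMomentBound.lintegral_sq_le`).  Hence `C = ‖G‖₁` works.

The Poincaré–Lelong formula is needed only for almost every `f`, and this makes a proof by slicing
possible.

* A form of bidegree `(m - 1, m - 1)` is a finite sum of terms `g · π^* vol`, where `π` is a
  projection `ℂᵐ → ℂᵐ⁻¹` along a complex line (`TestForm.exists_eq_sum`).  Indeed, every form of
  real codimension two is a combination of contractions `vol(x, y, …)`.  Invariance under the
  complex structure permits replacing `vol(x, y, …)` by its average with `vol(ix, iy, …)`, and this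
  average is, by polarization, a combination of contractions `vol(u, iu, …)`, each of which is a
  multiple of the pull-back of the volume form under the projection along `u`.
* For one term, the area formula turns the integral of `g · π^* vol` over the regular part of
  `Z_f` into an integral over `ℂᵐ⁻¹` of the sum of `g` over the fibres
  (`hasSum_integral_chartDecomposition`).  If `f` restricts to a separable polynomial on almost
  every fibre of `π`, then almost every fibre of `Z_f` consists of regular points, by the implicit
  function theorem (`mem_regularPoints_of_fderiv_ne_zero`), so that the sum over the fibre is the
  sum of `g` over the roots of a separable polynomial in one variable.  The one-variable formula
  `Δ log |t| = 2 π δ₀` and Fubini's theorem give the result (`exists_poincareLelong`).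
* The coefficient vectors `a` for which `f` is not separable on almost every line of a given
  direction lie in the zero locus of a nonzero polynomial, obtained from a discriminant
  (`exists_generic_separable`).  Such a locus is pluripolar (`isPluripolar_zeroLocus`), hence null
  for the law of `a`.
-/

namespace RandomZeros

open MeasureTheory Set Polynomial Filter Topology

/-! ### Restrictions of polynomials to lines -/

/-- The restriction `t ↦ f (z₀ + t u)` of a polynomial `f` to a complex line, as a polynomial
in `t`. -/
noncomputable def linePoly {σ : Type*} (f : MvPolynomial σ ℂ) (u z₀ : σ → ℂ) : ℂ[X] :=
  MvPolynomial.aeval (fun i => C (u i) * X + C (z₀ i)) f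

@[simp] theorem eval_linePoly {σ : Type*} (f : MvPolynomial σ ℂ) (u z₀ : σ → ℂ) (t : ℂ) :
    (linePoly f u z₀).eval t = MvPolynomial.eval (z₀ + t • u) f := by
  induction f using MvPolynomial.induction_on with
  | C c => simp [linePoly]
  | add p q hp hq => simp_all [linePoly]
  | mul_X p i hp =>
    have h : linePoly (p * MvPolynomial.X i) u z₀
        = linePoly p u z₀ * (C (u i) * X + C (z₀ i)) := by
      simp [linePoly]
    rw [h, eval_mul, hp]
    simp [mul_comm (u i), add_comm]

theorem natDegree_linePoly_le {σ : Type*} (f : MvPolynomial σ ℂ) (u z₀ : σ → ℂ) :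
    (linePoly f u z₀).natDegree ≤ f.totalDegree := by
  have := MvPolynomial.aeval_natDegree_le (m := f.totalDegree) (n := 1) f le_rfl
    (fun i => C (u i) * X + C (z₀ i)) (fun i => natDegree_linear_le)
  rwa [mul_one] at this

/-! ### Zero loci are null sets and pluripolar sets -/

/-- A measurable set that meets every real line through a given point in a countable set is a
Lebesgue null set: by Fubini's theorem, almost all of its dilates about that point are null. -/
theorem measure_eq_zero_of_countable_lines {E : Type*} [NormedAddCommGroup E] [NormedSpace ℝ E]
    [FiniteDimensional ℝ E] [MeasurableSpace E] [BorelSpace E] (μ : Measure E)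
    [μ.IsAddHaarMeasure] {Z : Set E} (hZ : MeasurableSet Z) (y₀ : E)
    (h : ∀ w : E, {s : ℝ | y₀ + s • w ∈ Z}.Countable) : μ Z = 0 := by
  have hm : MeasurableSet {p : ℝ × E | y₀ + p.1 • p.2 ∈ Z} :=
    (by fun_prop : Continuous fun p : ℝ × E => y₀ + p.1 • p.2).measurable hZ
  have h0 : ((volume : Measure ℝ).prod μ) {p : ℝ × E | y₀ + p.1 • p.2 ∈ Z} = 0 := by
    rw [Measure.prod_apply_symm hm]
    refine (lintegral_congr fun w => ?_).trans lintegral_zero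
    exact (h w).measure_zero _
  rw [Measure.prod_apply hm, lintegral_eq_zero_iff (measurable_measure_prodMk_left hm)] at h0
  have h1 : ∃ s : ℝ, s ≠ 0 ∧ μ (Prod.mk s ⁻¹' {p : ℝ × E | y₀ + p.1 • p.2 ∈ Z}) = 0 := by
    by_contra! hc
    have : (volume : Measure ℝ) ({0}ᶜ) = 0 := by
      refine measure_mono_null (fun s hs => ?_) h0
      exact hc s hs
    simp [measure_compl] at this
  obtain ⟨s, hs, hs0⟩ := h1
  have h2 : Prod.mk s ⁻¹' {p : ℝ × E | y₀ + p.1 • p.2 ∈ Z}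
      = (fun x => s • x) ⁻¹' ((fun x => y₀ + x) ⁻¹' Z) := rfl
  rw [h2, Measure.addHaar_preimage_smul μ hs, measure_preimage_add] at hs0
  have h3 : ENNReal.ofReal |(s ^ Module.finrank ℝ E)⁻¹| ≠ 0 := by
    have : (s ^ Module.finrank ℝ E)⁻¹ ≠ 0 := inv_ne_zero (pow_ne_zero _ hs)
    exact (ENNReal.ofReal_pos.mpr (abs_pos.mpr this)).ne'
  exact (mul_eq_zero.mp hs0).resolve_left h3

/-- The zero locus of a nonzero polynomial is a Lebesgue null set. -/
theorem ae_eval_ne_zero {k : ℕ} {P : MvPolynomial (Fin k) ℂ} (hP : P ≠ 0) :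
    ∀ᵐ y : Fin k → ℂ, MvPolynomial.eval y P ≠ 0 := by
  obtain ⟨y₀, hy₀⟩ : ∃ y, MvPolynomial.eval y P ≠ 0 := by
    by_contra! h
    exact hP (MvPolynomial.funext fun x => by simpa using h x)
  rw [ae_iff]
  simp only [not_not]
  refine measure_eq_zero_of_countable_lines volume
    ((isClosed_singleton (x := (0 : ℂ))).preimage (MvPolynomial.continuous_eval P)).measurableSet
    y₀ fun w => ?_
  have hne : linePoly P w y₀ ≠ 0 := fun h0 => hy₀ <| by
    have := eval_linePoly P w y₀ 0
    rw [h0] at this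
    simpa using this.symm
  have hfin : {t : ℂ | (linePoly P w y₀).IsRoot t}.Countable :=
    (Polynomial.finite_setOfPred_isRoot hne).countable
  refine (hfin.preimage Complex.ofReal_injective).mono fun s hs => ?_
  have : MvPolynomial.eval (y₀ + s • w) P = 0 := hs
  simpa [Polynomial.IsRoot.def] using this

open Real in
/-- Jensen's inequality for polynomials, in the form of the sub-mean value property of
`log |q|`. -/
theorem log_norm_eval_zero_le_circleAverage {q : ℂ[X]} (hq : q.eval 0 ≠ 0) {h : ℂ → ℝ}
    (hh : Continuous h) (hle : ∀ ζ : ℂ, ‖ζ‖ = 1 → q.eval ζ ≠ 0 → log ‖q.eval ζ‖ ≤ h ζ) :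
    log ‖q.eval 0‖ ≤ circleAverage h 0 1 := by
  have hq0 : q ≠ 0 := fun h0 => hq (by simp [h0])
  have han : AnalyticOnNhd ℂ (fun z => q.eval z) univ := AnalyticOnNhd.eval_polynomial q
  have h1 : log ‖q.eval 0‖ ≤ circleAverage (fun z => log ‖q.eval z‖) 0 1 := by
    rw [AnalyticOnNhd.circleAverage_log_norm one_ne_zero (han.mono (subset_univ _)) hq]
    refine le_add_of_nonneg_left (finsum_nonneg fun u => ?_)
    by_cases hu : u ∈ Metric.closedBall (0 : ℂ) |1|
    · refine mul_nonneg ?_ ?_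
      · have := MeromorphicOn.AnalyticOnNhd.divisor_nonneg
          (han.mono (subset_univ (Metric.closedBall (0 : ℂ) |1|))) u
        exact_mod_cast this
      · rcases eq_or_ne u 0 with rfl | hu0
        · simp
        · refine log_nonneg ?_
          have h2 : ‖u‖ ≤ 1 := by simpa using hu
          simpa using (one_le_inv₀ (norm_pos_iff.mpr hu0)).mpr h2
    · simp [Function.locallyFinsuppWithin.apply_eq_zero_of_notMem _ hu]
  refine h1.trans ?_
  unfold circleAverage
  refine smul_le_smul_of_nonneg_left ?_ (by positivity)
  have hi : CircleIntegrable (fun z => log ‖q.eval z‖) 0 1 :=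
    (han.mono (subset_univ _)).meromorphicOn.circleIntegrable_log_norm
  refine intervalIntegral.integral_mono_ae two_pi_pos.le hi
    (hh.comp (continuous_circleMap 0 1)).continuousOn.intervalIntegrable ?_
  have hc : {θ : ℝ | q.IsRoot (circleMap 0 1 θ)}.Countable :=
    (Polynomial.finite_setOfPred_isRoot hq0).countable.preimage_circleMap 0 one_ne_zero
  filter_upwards [hc.ae_notMem volume] with θ hθ
  exact hle _ (by simp) hθ

open Real in
/-- The zero locus of a nonzero polynomial `P` is pluripolar, being the `-∞` locus of
`log |P|`. -/
theorem isPluripolar_zeroLocus {k : ℕ} {P : MvPolynomial (Fin k) ℂ} (hP : P ≠ 0) :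
    IsPluripolar {a : Fin k → ℂ | MvPolynomial.eval a P = 0} := by
  intro z₀ _
  obtain ⟨y₀, hy₀⟩ : ∃ y, MvPolynomial.eval y P ≠ 0 := by
    by_contra! h
    exact hP (MvPolynomial.funext fun x => by simpa using h x)
  have key : ∀ a : Fin k → ℂ, ∀ x : ℝ,
      (ENNReal.log ‖MvPolynomial.eval a P‖ₑ ≤ (x : EReal)) ↔
        (MvPolynomial.eval a P ≠ 0 → log ‖MvPolynomial.eval a P‖ ≤ x) := by
    intro a x
    by_cases h : MvPolynomial.eval a P = 0
    · simp [h]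
    · have h1 : ENNReal.log ‖MvPolynomial.eval a P‖ₑ
          = ((log ‖MvPolynomial.eval a P‖ : ℝ) : EReal) := by
        rw [ENNReal.log_pos_real (by simpa using h) (by simp)]
        simp
      rw [h1, EReal.coe_le_coe_iff]
      simp [h]
  refine ⟨univ, isOpen_univ, isConnected_univ, mem_univ _,
    fun a => ENNReal.log ‖MvPolynomial.eval a P‖ₑ, ⟨?_, ?_, ?_⟩, ⟨y₀, mem_univ _, ?_⟩, ?_⟩
  · have : Continuous fun a : Fin k → ℂ => ENNReal.log ‖MvPolynomial.eval a P‖ₑ :=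
      ENNReal.continuous_log.comp (MvPolynomial.continuous_eval P).enorm
    exact this.upperSemicontinuous.upperSemicontinuousOn _
  · intro z _
    simp [lt_top_iff_ne_top]
  · intro a b _ h hh hle
    rw [key]
    intro ha
    have := log_norm_eval_zero_le_circleAverage (q := linePoly P b a) (by simpa using ha) hh
      (fun ζ hζ hne => by
        have := (key _ _).1 (hle ζ hζ)
        simp only [eval_linePoly] at hne ⊢
        exact this hne)
    simpa using this
  · simpa using hy₀
  · intro z hz
    have : MvPolynomial.eval z P = 0 := hz.1
    simp [this]

/-! ### Generic polynomials are separable along almost all parallel lines -/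

theorem separable_of_resultant_ne_zero {K : Type*} [Field K] {f : K[X]} {n : ℕ} (hn : 1 ≤ n)
    (hf : f.natDegree ≤ n) (h : f.resultant f.derivative n (n - 1) ≠ 0) : f.Separable := by
  obtain ⟨a, b, -, -, hab⟩ := exists_mul_add_mul_eq_C_resultant f f.derivative hf
    ((natDegree_derivative_le f).trans (Nat.sub_le_sub_right hf 1)) (Or.inl (by omega : n ≠ 0))
  set r := f.resultant f.derivative n (n - 1)
  refine ⟨C r⁻¹ * a, C r⁻¹ * b, ?_⟩
  calc C r⁻¹ * a * f + C r⁻¹ * b * f.derivative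
      = C r⁻¹ * (f * a + f.derivative * b) := by ring
    _ = 1 := by rw [hab, ← C_mul, inv_mul_cancel₀ h, C_1]

theorem resultant_derivative_ne_zero {K : Type*} [Field K] [CharZero K] {f : K[X]} {n : ℕ}
    (hf : f.natDegree = n) (h : f.Separable) : f.resultant f.derivative n (n - 1) ≠ 0 := by
  subst hf
  intro h0
  have h1 := natDegree_derivative f
  rw [← h1, resultant_eq_zero_iff] at h0
  exact h0.2 h

/-- The restriction of `f` to the line through `A y` in the direction `u`, with the parameter `y`
as an indeterminate. -/
noncomputable def linePolyFamily {σ : Type*} {k : ℕ} (f : MvPolynomial σ ℂ) (u : σ → ℂ)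
    (A : (Fin k → ℂ) →ₗ[ℂ] (σ → ℂ)) : (MvPolynomial (Fin k) ℂ)[X] :=
  MvPolynomial.aeval (fun i => C (MvPolynomial.C (u i)) * X +
    C (∑ j, MvPolynomial.C (A (Pi.single j 1) i) * MvPolynomial.X j)) f

theorem map_linePolyFamily {σ : Type*} {k : ℕ} (f : MvPolynomial σ ℂ) (u : σ → ℂ)
    (A : (Fin k → ℂ) →ₗ[ℂ] (σ → ℂ)) (y : Fin k → ℂ) :
    (linePolyFamily f u A).map (MvPolynomial.eval y) = linePoly f u (A y) := by
  have hA : ∀ i, ∑ j, A (Pi.single j 1) i * y j = A y i := by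
    intro i
    conv_rhs => rw [LinearMap.pi_apply_eq_sum_univ A y]
    simp only [Finset.sum_apply, Pi.smul_apply, smul_eq_mul, mul_comm]
    refine Finset.sum_congr rfl fun j _ => ?_
    have : (Pi.single j 1 : Fin k → ℂ) = fun l => if j = l then 1 else 0 := by
      ext l
      simp [Pi.single_apply, eq_comm]
    rw [this]
  induction f using MvPolynomial.induction_on with
  | C c =>
    simp only [linePolyFamily, linePoly, MvPolynomial.aeval_C]
    rw [IsScalarTower.algebraMap_apply ℂ (MvPolynomial (Fin k) ℂ), Polynomial.algebraMap_eq,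
      map_C, MvPolynomial.algebraMap_eq, MvPolynomial.eval_C]
    rfl
  | add p q hp hq => simp_all [linePolyFamily, linePoly]
  | mul_X p i hp =>
    simp only [linePolyFamily, linePoly, map_mul, Polynomial.map_mul, MvPolynomial.aeval_X] at hp ⊢
    rw [hp]
    simp [Polynomial.map_sum, ← hA]

/-- The restriction of `∑ⱼ aⱼ pⱼ` to the line through `0` in the direction `u`, with the
coefficients `a` as indeterminates. -/
noncomputable def coeffFamily {σ : Type*} {d : ℕ} (p : Fin d → MvPolynomial σ ℂ) (u : σ → ℂ) :
    (MvPolynomial (Fin d) ℂ)[X] :=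
  ∑ j, C (MvPolynomial.X j) * (linePoly (p j) u 0).map MvPolynomial.C

theorem map_coeffFamily {σ : Type*} {d : ℕ} (p : Fin d → MvPolynomial σ ℂ) (u : σ → ℂ)
    (a : Fin d → ℂ) :
    (coeffFamily p u).map (MvPolynomial.eval a) = linePoly (∑ j, a j • p j) u 0 := by
  have h : (MvPolynomial.eval a).comp (MvPolynomial.C (σ := Fin d)) = RingHom.id ℂ := by
    ext x; simp
  simp only [coeffFamily, linePoly, Polynomial.map_sum, Polynomial.map_mul, map_C, map_sum,
    map_smul, MvPolynomial.eval_X, Polynomial.map_map, h, Polynomial.map_id, smul_eq_C_mul]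

/-- For a generic member `f` of `𝒫_n` (off the zero locus of a nonzero polynomial in the
coefficients), the restrictions of `f` to almost all lines of a given direction are separable. -/
theorem exists_generic_separable {m n k : ℕ} (hn : 1 ≤ n)
    (p : Module.Basis (Fin (polyDim m n)) ℂ (polySpace m n)) {u : Fin m → ℂ} (hu : u ≠ 0)
    (A : (Fin k → ℂ) →ₗ[ℂ] (Fin m → ℂ)) :
    ∃ P : MvPolynomial (Fin (polyDim m n)) ℂ, P ≠ 0 ∧ ∀ a, MvPolynomial.eval a P ≠ 0 →
      ∀ᵐ y : Fin k → ℂ, (linePoly (polyOf p a) u (A y)).Separable := by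
  set F := coeffFamily (fun j => (p j : MvPolynomial (Fin m) ℂ)) u with hF
  have hres : ∀ a, MvPolynomial.eval a (F.resultant F.derivative n (n - 1)) =
      (linePoly (polyOf p a) u 0).resultant (linePoly (polyOf p a) u 0).derivative n (n - 1) := by
    intro a
    rw [← resultant_map_map, ← derivative_map, hF, map_coeffFamily]
    rfl
  refine ⟨F.resultant F.derivative n (n - 1), fun h0 => ?_, fun a ha => ?_⟩
  · -- the resultant does not vanish at the polynomial `(zᵢ / uᵢ) ^ n - 1`
    obtain ⟨i, hi⟩ : ∃ i, u i ≠ 0 := by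
      by_contra! h
      exact hu (funext h)
    set f : MvPolynomial (Fin m) ℂ := (MvPolynomial.C (u i)⁻¹ * MvPolynomial.X i) ^ n - 1 with hf
    have hmem : f ∈ polySpace m n := by
      rw [MvPolynomial.mem_restrictTotalDegree]
      refine (MvPolynomial.totalDegree_sub _ _).trans (max_le ?_ (by simp))
      refine (MvPolynomial.totalDegree_pow _ _).trans ?_
      have : (MvPolynomial.C (σ := Fin m) (u i)⁻¹ * MvPolynomial.X i).totalDegree ≤ 1 :=
        (MvPolynomial.totalDegree_mul _ _).trans (by simp)
      nlinarith
    have hline : linePoly f u 0 = X ^ n - C 1 := by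
      simp only [hf, linePoly, map_sub, map_pow, map_mul, MvPolynomial.aeval_X, map_one,
        Pi.zero_apply, C_0, add_zero, MvPolynomial.aeval_C]
      rw [Polynomial.algebraMap_eq, ← mul_assoc, ← C_mul, inv_mul_cancel₀ hi, C_1, one_mul]
    have hpoly : polyOf p (p.repr ⟨f, hmem⟩) = f := by
      have := congrArg (polySpace m n).subtype (p.sum_repr ⟨f, hmem⟩)
      rw [map_sum] at this
      exact this
    have := hres (p.repr ⟨f, hmem⟩)
    rw [h0, map_zero, hpoly, hline] at this
    refine resultant_derivative_ne_zero (natDegree_X_pow_sub_C) ?_ this.symm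
    exact separable_X_pow_sub_C 1 (by exact_mod_cast (by omega : n ≠ 0)) one_ne_zero
  · set G := linePolyFamily (polyOf p a) u A with hG
    have hdeg : (polyOf p a).totalDegree ≤ n := by
      rw [← MvPolynomial.mem_restrictTotalDegree]
      exact Submodule.sum_mem _ fun j _ => Submodule.smul_mem _ _ (p j).2
    have hresG : ∀ y, MvPolynomial.eval y (G.resultant G.derivative n (n - 1)) =
        (linePoly (polyOf p a) u (A y)).resultant
          (linePoly (polyOf p a) u (A y)).derivative n (n - 1) := by
      intro y
      rw [← resultant_map_map, ← derivative_map, hG, map_linePolyFamily]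
    have hG0 : G.resultant G.derivative n (n - 1) ≠ 0 := by
      intro h0
      have := hresG 0
      rw [h0, map_zero, map_zero, ← hres] at this
      exact ha this.symm
    filter_upwards [ae_eval_ne_zero hG0] with y hy
    exact separable_of_resultant_ne_zero hn ((natDegree_linePoly_le _ _ _).trans hdeg)
      (by rwa [← hresG])

/-! ### The logarithmic potential in one variable -/

/-- The Laplacian of `g` along the complex direction `u`, that is,
`D²g(u, u) + D²g(iu, iu) = 4 ∂_u ∂̄_u g`. -/
noncomputable def dirLaplacian {E : Type*} [NormedAddCommGroup E] [NormedSpace ℂ E] (u : E)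
    (g : E → ℝ) (z : E) : ℝ :=
  fderiv ℝ (fun z => fderiv ℝ g z u) z u +
    fderiv ℝ (fun z => fderiv ℝ g z (Complex.I • u)) z (Complex.I • u)

section Laplacian

variable {E : Type*} [NormedAddCommGroup E] [NormedSpace ℂ E]

theorem contDiff_fderiv_apply_const {g : E → ℝ} (hg : ContDiff ℝ ∞ g) (v : E) :
    ContDiff ℝ ∞ fun z => fderiv ℝ g z v :=
  (hg.fderiv_right (m := ∞) (by simp)).clm_apply contDiff_const

theorem hasCompactSupport_fderiv_apply {g : E → ℝ} (hg : HasCompactSupport g) (v : E) :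
    HasCompactSupport fun z => fderiv ℝ g z v :=
  hg.fderiv_apply ℝ v

theorem continuous_dirLaplacian {g : E → ℝ} (hg : ContDiff ℝ ∞ g) (u : E) :
    Continuous (dirLaplacian u g) :=
  (contDiff_fderiv_apply_const (contDiff_fderiv_apply_const hg u) u).continuous.add
    (contDiff_fderiv_apply_const (contDiff_fderiv_apply_const hg _) _).continuous

theorem hasCompactSupport_dirLaplacian {g : E → ℝ} (hg : HasCompactSupport g) (u : E) :
    HasCompactSupport (dirLaplacian u g) :=
  (hasCompactSupport_fderiv_apply (hasCompactSupport_fderiv_apply hg u) u).add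
    (hasCompactSupport_fderiv_apply (hasCompactSupport_fderiv_apply hg _) _)

/-- The Laplacian along `u` is computed on the complex lines in the direction `u`. -/
theorem dirLaplacian_comp_line {g : E → ℝ} (hg : ContDiff ℝ ∞ g) (u z₀ : E) (t : ℂ) :
    dirLaplacian 1 (fun t : ℂ => g (z₀ + t • u)) t = dirLaplacian u g (z₀ + t • u) := by
  have key : ∀ {h : E → ℝ} (_ : ContDiff ℝ ∞ h) (t c : ℂ),
      fderiv ℝ (fun t : ℂ => h (z₀ + t • u)) t c = fderiv ℝ h (z₀ + t • u) (c • u) := by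
    intro h hh t c
    have h1 : HasFDerivAt (fun t : ℂ => z₀ + t • u)
        ((ContinuousLinearMap.toSpanSingleton ℂ u).restrictScalars ℝ) t := by
      have := (ContinuousLinearMap.toSpanSingleton ℂ u).hasFDerivAt (x := t)
      exact (this.const_add z₀).restrictScalars ℝ
    have h2 : HasFDerivAt h (fderiv ℝ h (z₀ + t • u)) (z₀ + t • u) :=
      (hh.differentiable (by simp) _).hasFDerivAt
    have h3 : HasFDerivAt (fun t : ℂ => h (z₀ + t • u)) _ t := h2.comp t h1
    rw [h3.fderiv]
    simp
  unfold dirLaplacian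
  simp only [key hg]
  rw [key (contDiff_fderiv_apply_const hg _), key (contDiff_fderiv_apply_const hg _)]
  simp

end Laplacian

theorem integral_fderiv_apply_eq_zero {g : ℂ → ℝ} (hg : ContDiff ℝ ∞ g)
    (hc : HasCompactSupport g) (v : ℂ) : ∫ t, fderiv ℝ g t v = 0 := by
  have h := integral_mul_fderiv_eq_neg_fderiv_mul_of_integrable (μ := (volume : Measure ℂ))
    (f := fun _ => (1 : ℝ)) (g := g) (v := v) (by simp)
    (by simpa using ((contDiff_fderiv_apply_const hg v).continuous.integrable_of_hasCompactSupport
      (hasCompactSupport_fderiv_apply hc v) : Integrable _ volume))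
    (by simpa using (hg.continuous.integrable_of_hasCompactSupport hc : Integrable g volume))
    (fun x _ => by fun_prop) (fun x _ => hg.differentiable (by simp) x)
  simpa using h

theorem integral_dirLaplacian_eq_zero {g : ℂ → ℝ} (hg : ContDiff ℝ ∞ g)
    (hc : HasCompactSupport g) : ∫ t, dirLaplacian 1 g t = 0 := by
  unfold dirLaplacian
  rw [integral_add, integral_fderiv_apply_eq_zero (contDiff_fderiv_apply_const hg _)
    (hasCompactSupport_fderiv_apply hc _),
    integral_fderiv_apply_eq_zero (contDiff_fderiv_apply_const hg _)
    (hasCompactSupport_fderiv_apply hc _), add_zero]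
  all_goals
    exact (contDiff_fderiv_apply_const (contDiff_fderiv_apply_const hg _)
      _).continuous.integrable_of_hasCompactSupport
      (hasCompactSupport_fderiv_apply (hasCompactSupport_fderiv_apply hc _) _)

theorem integral_mul_fderiv_fderiv {g ℓ : ℂ → ℝ} (hg : ContDiff ℝ ∞ g)
    (hc : HasCompactSupport g) (hℓ : ContDiff ℝ ∞ ℓ) (v : ℂ) :
    ∫ t, ℓ t * fderiv ℝ (fun z => fderiv ℝ g z v) t v
      = ∫ t, fderiv ℝ (fun z => fderiv ℝ ℓ z v) t v * g t := by
  have hg' := contDiff_fderiv_apply_const hg v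
  have hg'' := contDiff_fderiv_apply_const hg' v
  have hℓ' := contDiff_fderiv_apply_const hℓ v
  have hℓ'' := contDiff_fderiv_apply_const hℓ' v
  have hc' := hasCompactSupport_fderiv_apply hc v
  have hc'' := hasCompactSupport_fderiv_apply hc' v
  have hi : ∀ {a b : ℂ → ℝ}, ContDiff ℝ ∞ a → ContDiff ℝ ∞ b → HasCompactSupport b →
      Integrable (fun t => a t * b t) := fun ha hb hbc =>
    (ha.continuous.mul hb.continuous).integrable_of_hasCompactSupport hbc.mul_left
  rw [integral_mul_fderiv_eq_neg_fderiv_mul_of_integrable (hi hℓ' hg' hc') (hi hℓ hg'' hc'')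
    (hi hℓ hg' hc') (fun x _ => hℓ.differentiable (by simp) x)
    (fun x _ => hg'.differentiable (by simp) x),
    integral_mul_fderiv_eq_neg_fderiv_mul_of_integrable (hi hℓ'' hg hc) (hi hℓ' hg' hc')
    (hi hℓ' hg hc) (fun x _ => hℓ'.differentiable (by simp) x)
    (fun x _ => hg.differentiable (by simp) x), neg_neg]

theorem locallyIntegrable_log_norm : LocallyIntegrable fun t : ℂ => Real.log ‖t‖ := by
  have h : ∀ r : ℝ, 0 < r → IntegrableOn (fun t : ℂ => Real.log ‖t‖) (Metric.ball 0 r) := by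
    intro r hr
    rw [integrableOn_fun_norm_addHaar (μ := (volume : Measure ℂ)) (f := Real.log)]
    have h1 : IntegrableOn Real.log (Ioo 0 r) := by
      have := (intervalIntegral.intervalIntegrable_log' (a := 0) (b := r)).1
      exact this.mono_set Ioo_subset_Ioc_self
    simp only [Complex.finrank_real_complex, smul_eq_mul]
    refine Integrable.bdd_mul (c := r) h1 (by fun_prop) ?_
    filter_upwards [ae_restrict_mem measurableSet_Ioo] with x hx
    simp only [Nat.add_one_sub_one, pow_one, Real.norm_eq_abs]
    rw [abs_of_pos hx.1]
    exact hx.2.le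
  intro x
  exact ⟨Metric.ball 0 (‖x‖ + 1), Metric.isOpen_ball.mem_nhds (by simp), h _ (by positivity)⟩

theorem integral_two_div_one_add_norm_sq_sq :
    ∫ s : ℂ, 2 / (1 + ‖s‖ ^ 2) ^ 2 = 2 * Real.pi := by
  rw [integral_fun_norm_addHaar (μ := (volume : Measure ℂ)) (f := fun y => 2 / (1 + y ^ 2) ^ 2)]
  have hd : ∀ x ∈ Ioi (0 : ℝ), HasDerivAt (fun y : ℝ => -(1 + y ^ 2)⁻¹)
      (x * (2 / (1 + x ^ 2) ^ 2)) x := by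
    intro x _
    have h1 : HasDerivAt (fun y : ℝ => 1 + y ^ 2) (2 * x) x := by
      simpa using ((hasDerivAt_id x).pow 2).const_add 1
    convert! (h1.inv (by positivity)).neg using 1
    ring
  have ht : Tendsto (fun y : ℝ => -(1 + y ^ 2)⁻¹) atTop (𝓝 0) := by
    have : Tendsto (fun y : ℝ => 1 + y ^ 2) atTop atTop :=
      tendsto_atTop_add_const_left _ _ (tendsto_pow_atTop two_ne_zero)
    simpa using this.inv_tendsto_atTop.neg
  have h2 : ∫ x in Ioi (0 : ℝ), x * (2 / (1 + x ^ 2) ^ 2) = 1 := by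
    rw [integral_Ioi_of_hasDerivAt_of_nonneg' (l := 0) (fun x hx => ?_) (fun x hx => ?_) ht]
    · simp
    · rcases eq_or_lt_of_le (show (0 : ℝ) ≤ x from hx) with rfl | hx
      · have h1 : HasDerivAt (fun y : ℝ => 1 + y ^ 2) (2 * 0) 0 := by
          simpa using ((hasDerivAt_id (0 : ℝ)).pow 2).const_add 1
        convert! (h1.inv (by positivity)).neg using 1
        ring
      · exact hd x hx
    · have : (0 : ℝ) < x := hx
      positivity
  simp only [Complex.finrank_real_complex, smul_eq_mul, Nat.add_one_sub_one, pow_one, h2]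
  simp [Measure.real, Complex.volume_ball]

/-- The logarithm is the fundamental solution of the Laplacian in the plane:
`Δ log |t| = 2π δ₀`.  One regularizes `log |t|` to `½ log (|t|² + ε²)`, whose Laplacian
`2 ε² / (|t|² + ε²)²` is an approximate identity of mass `2π`. -/
theorem integral_log_norm_mul_dirLaplacian_zero {g : ℂ → ℝ} (hg : ContDiff ℝ ∞ g)
    (hc : HasCompactSupport g) :
    ∫ t, Real.log ‖t‖ * dirLaplacian 1 g t = 2 * Real.pi * g 0 := by
  have hΔc := continuous_dirLaplacian hg 1
  have hΔs := hasCompactSupport_dirLaplacian hc 1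
  set Q : ℝ → ℂ → ℝ := fun ε t => ‖t‖ ^ 2 + ε ^ 2 with hQ
  have hQpos : ∀ {ε : ℝ}, 0 < ε → ∀ t, 0 < Q ε t := fun hε t => by simp only [hQ]; positivity
  have hQd : ∀ ε, ContDiff ℝ ∞ (Q ε) := fun ε => (contDiff_norm_sq ℝ).add contDiff_const
  have hQ' : ∀ ε t v, fderiv ℝ (Q ε) t v = 2 * inner ℝ t v := by
    intro ε t v
    have h := ((hasStrictFDerivAt_norm_sq t).hasFDerivAt.add_const (ε ^ 2))
    rw [h.fderiv]
    simp
    ring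
  -- the Laplacian of the regularized logarithm
  have hreg : ∀ {ε : ℝ}, 0 < ε → ∫ t, (1 / 2 * Real.log (Q ε t)) * dirLaplacian 1 g t
      = ∫ t, 2 * ε ^ 2 / Q ε t ^ 2 * g t := by
    intro ε hε
    set ℓ : ℂ → ℝ := fun t => 1 / 2 * Real.log (Q ε t) with hℓ
    have hℓd : ContDiff ℝ ∞ ℓ := contDiff_const.mul ((hQd ε).log fun t => (hQpos hε t).ne')
    have hℓ1 : ∀ v, (fun t => fderiv ℝ ℓ t v) = fun t => inner ℝ t v / Q ε t := by
      intro v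
      ext t
      have h1 : HasFDerivAt (Q ε) (fderiv ℝ (Q ε) t) t :=
        ((hQd ε).differentiable (by simp) t).hasFDerivAt
      have h2 := (h1.log (hQpos hε t).ne').const_mul (1 / 2)
      rw [h2.fderiv]
      simp only [smul_apply, hQ', smul_eq_mul]
      field_simp
    have hℓ2 : ∀ v t, fderiv ℝ (fun t => fderiv ℝ ℓ t v) t v
        = inner ℝ v v / Q ε t - 2 * inner ℝ t v ^ 2 / Q ε t ^ 2 := by
      intro v t
      rw [hℓ1]
      have h1 : HasFDerivAt (Q ε) (fderiv ℝ (Q ε) t) t :=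
        ((hQd ε).differentiable (by simp) t).hasFDerivAt
      have h2 : HasFDerivAt (fun t : ℂ => inner ℝ t v) (innerSL ℝ v) t := by
        have := (innerSL ℝ v).hasFDerivAt (x := t)
        refine this.congr_of_eventuallyEq (Eventually.of_forall fun x => ?_)
        simp [real_inner_comm]
      have h3 := h2.mul ((hasDerivAt_inv (hQpos hε t).ne').comp_hasFDerivAt t h1)
      have h4 : HasFDerivAt (fun t => inner ℝ t v / Q ε t) _ t := h3
      rw [h4.fderiv]
      have := (hQpos hε t).ne'
      simp only [smul_apply, add_apply, innerSL_apply_apply, hQ', smul_eq_mul, Function.comp_apply]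
      field_simp
      ring
    have hi : ∀ v, Integrable
        (fun t => ℓ t * fderiv ℝ (fun z => fderiv ℝ g z v) t v) := fun v =>
      (hℓd.continuous.mul (contDiff_fderiv_apply_const (contDiff_fderiv_apply_const hg v)
        v).continuous).integrable_of_hasCompactSupport
        (hasCompactSupport_fderiv_apply (hasCompactSupport_fderiv_apply hc v) v).mul_left
    have hi' : ∀ v, Integrable
        (fun t => fderiv ℝ (fun z => fderiv ℝ ℓ z v) t v * g t) := fun v =>
      ((contDiff_fderiv_apply_const (contDiff_fderiv_apply_const hℓd v) v).continuous.mul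
        hg.continuous).integrable_of_hasCompactSupport hc.mul_left
    unfold dirLaplacian
    simp only [mul_add]
    rw [integral_add (hi _) (hi _), integral_mul_fderiv_fderiv hg hc hℓd,
      integral_mul_fderiv_fderiv hg hc hℓd, ← integral_add (hi' _) (hi' _)]
    refine integral_congr_ae (Eventually.of_forall fun t => ?_)
    simp only [hℓ2]
    have hne := (hQpos hε t).ne'
    have hn : ‖t‖ ^ 2 = t.re ^ 2 + t.im ^ 2 := by
      rw [Complex.sq_norm, Complex.normSq_apply]; ring
    have hQe : Q ε t = t.re ^ 2 + t.im ^ 2 + ε ^ 2 := by simp only [hQ, hn]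
    simp only [Complex.inner, smul_eq_mul, mul_one, map_one, one_mul]
    simp only [Complex.one_re, Complex.conj_I, Complex.conj_re, Complex.conj_im, Complex.mul_re,
      Complex.neg_re, Complex.neg_im, Complex.I_re, Complex.I_im]
    rw [hQe] at hne ⊢
    field_simp
    ring
  -- the approximate identity
  have hscale : ∀ {ε : ℝ}, 0 < ε → ∫ t, 2 * ε ^ 2 / Q ε t ^ 2 * g t
      = ∫ s : ℂ, 2 / (1 + ‖s‖ ^ 2) ^ 2 * g (ε • s) := by
    intro ε hε
    have h := Measure.integral_comp_smul (volume : Measure ℂ)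
      (fun t => 2 * ε ^ 2 / Q ε t ^ 2 * g t) ε
    have h1 : |(ε ^ Module.finrank ℝ ℂ)⁻¹| = (ε ^ 2)⁻¹ := by
      rw [Complex.finrank_real_complex, abs_of_pos (by positivity)]
    rw [h1, smul_eq_mul] at h
    rw [← mul_right_inj' (a := (ε ^ 2)⁻¹) (by positivity), ← h, ← integral_const_mul]
    refine integral_congr_ae (Eventually.of_forall fun s => ?_)
    have : Q ε (ε • s) = ε ^ 2 * (1 + ‖s‖ ^ 2) := by
      simp only [hQ, norm_smul, Real.norm_eq_abs, mul_pow, sq_abs]; ring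
    simp only [this]
    field_simp
  set e : ℕ → ℝ := fun n => 1 / ((n : ℝ) + 1) with he
  have he0 : ∀ n, 0 < e n := fun n => Nat.one_div_pos_of_nat
  have he1 : ∀ n, e n ≤ 1 := fun n => by
    simp only [he]
    rw [div_le_one (by positivity)]
    linarith [(Nat.cast_nonneg n : (0 : ℝ) ≤ n)]
  have het : Tendsto e atTop (𝓝 0) := tendsto_one_div_add_atTop_nhds_zero_nat
  have hL : Tendsto (fun n => ∫ t, (1 / 2 * Real.log (Q (e n) t)) * dirLaplacian 1 g t) atTop
      (𝓝 (∫ t, Real.log ‖t‖ * dirLaplacian 1 g t)) := by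
    have hb : Integrable (fun t => (|Real.log ‖t‖| + ‖t‖ ^ 2) * |dirLaplacian 1 g t|) := by
      have hl : LocallyIntegrable (fun t : ℂ => |Real.log ‖t‖| + ‖t‖ ^ 2) :=
        LocallyIntegrable.add (fun x => let ⟨U, hU, hi⟩ := locallyIntegrable_log_norm x
          ⟨U, hU, hi.norm⟩)
          (by fun_prop : Continuous fun t : ℂ => ‖t‖ ^ 2).locallyIntegrable
      have := hl.integrable_smul_left_of_hasCompactSupport (g := fun t => |dirLaplacian 1 g t|)
        hΔc.abs hΔs.norm
      simpa [mul_comm] using this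
    refine tendsto_integral_of_dominated_convergence _ (fun n => ?_) hb (fun n => ?_) ?_
    · exact ((((hQd (e n)).continuous.log fun t => (hQpos (he0 n) t).ne').const_mul _).mul
        hΔc).aestronglyMeasurable
    · have h0 : ∀ᵐ t : ℂ, t ≠ 0 := by simp [ae_iff]
      filter_upwards [h0] with t ht
      rw [norm_mul, Real.norm_eq_abs, Real.norm_eq_abs]
      refine mul_le_mul_of_nonneg_right ?_ (abs_nonneg _)
      have htp : 0 < ‖t‖ := norm_pos_iff.mpr ht
      have hlow : Real.log ‖t‖ ≤ 1 / 2 * Real.log (Q (e n) t) := by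
        have : Real.log (‖t‖ ^ 2) ≤ Real.log (Q (e n) t) :=
          Real.log_le_log (by positivity) (by simp only [hQ]; nlinarith [he0 n])
        rw [Real.log_pow] at this
        push_cast at this
        linarith
      have hup : 1 / 2 * Real.log (Q (e n) t) ≤ ‖t‖ ^ 2 := by
        have := Real.log_le_sub_one_of_pos (hQpos (he0 n) t)
        have h2 : Q (e n) t ≤ ‖t‖ ^ 2 + 1 := by
          simp only [hQ]
          nlinarith [he0 n, he1 n]
        nlinarith [sq_nonneg ‖t‖]
      rw [abs_le]
      constructor
      · nlinarith [neg_abs_le (Real.log ‖t‖), sq_nonneg ‖t‖]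
      · linarith [abs_nonneg (Real.log ‖t‖)]
    · have h0 : ∀ᵐ t : ℂ, t ≠ 0 := by simp [ae_iff]
      filter_upwards [h0] with t ht
      refine Tendsto.mul_const _ ?_
      have hQt : Tendsto (fun n => Q (e n) t) atTop (𝓝 (‖t‖ ^ 2)) := by
        have := (het.pow 2).const_add (‖t‖ ^ 2)
        simpa [hQ] using this
      have htp : 0 < ‖t‖ := norm_pos_iff.mpr ht
      have := (hQt.log (by positivity)).const_mul (1 / 2)
      rw [Real.log_pow] at this
      convert this using 2
      push_cast
      ring
  have hR : Tendsto (fun n => ∫ s : ℂ, 2 / (1 + ‖s‖ ^ 2) ^ 2 * g (e n • s)) atTop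
      (𝓝 (∫ s : ℂ, 2 / (1 + ‖s‖ ^ 2) ^ 2 * g 0)) := by
    obtain ⟨M, hM⟩ := hc.exists_bound_of_continuous hg.continuous
    have hint : Integrable fun s : ℂ => 2 / (1 + ‖s‖ ^ 2) ^ 2 := by
      have := (integrable_rpow_neg_one_add_norm_sq (E := ℂ) (μ := volume) (r := 4)
        (by simp; norm_num)).const_mul 2
      refine this.congr (Eventually.of_forall fun s => ?_)
      have h1 : (0 : ℝ) ≤ 1 + ‖s‖ ^ 2 := by positivity
      simp only
      rw [show (-4 / 2 : ℝ) = -(2 : ℕ) by norm_num, Real.rpow_neg h1, Real.rpow_natCast]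
      rfl
    refine tendsto_integral_of_dominated_convergence (fun s => 2 / (1 + ‖s‖ ^ 2) ^ 2 * M)
      (fun n => ?_) (hint.mul_const M) (fun n => Eventually.of_forall fun s => ?_)
      (Eventually.of_forall fun s => ?_)
    · have : Continuous fun s : ℂ => 2 / (1 + ‖s‖ ^ 2) ^ 2 * g (e n • s) := by
        have hgc := hg.continuous
        refine Continuous.mul (Continuous.div (by fun_prop) (by fun_prop) fun s => ?_) (by fun_prop)
        positivity
      exact this.aestronglyMeasurable
    · rw [norm_mul, Real.norm_of_nonneg (by positivity : (0 : ℝ) ≤ 2 / (1 + ‖s‖ ^ 2) ^ 2)]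
      exact mul_le_mul_of_nonneg_left (hM _) (by positivity)
    · refine Tendsto.const_mul _ ((hg.continuous.tendsto 0).comp ?_)
      simpa using het.smul_const s
  have hEq : (fun n => ∫ t, (1 / 2 * Real.log (Q (e n) t)) * dirLaplacian 1 g t)
      = fun n => ∫ s : ℂ, 2 / (1 + ‖s‖ ^ 2) ^ 2 * g (e n • s) := by
    ext n
    rw [hreg (he0 n), hscale (he0 n)]
  rw [hEq] at hL
  rw [tendsto_nhds_unique hL hR, integral_mul_const, integral_two_div_one_add_norm_sq_sq]

theorem integrable_log_norm_sub_mul_dirLaplacian {g : ℂ → ℝ} (hg : ContDiff ℝ ∞ g)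
    (hc : HasCompactSupport g) (r : ℂ) :
    Integrable fun t => Real.log ‖t - r‖ * dirLaplacian 1 g t := by
  have h1 : LocallyIntegrable fun t : ℂ => Real.log ‖t - r‖ := by
    intro x
    obtain ⟨U, hU, hi⟩ := locallyIntegrable_log_norm (x - r)
    refine ⟨(fun t => t - r) ⁻¹' U, (continuous_sub_right r).continuousAt hU, ?_⟩
    have hmp := (measurePreserving_sub_right (volume : Measure ℂ) r)
    exact (hmp.integrableOn_comp_preimage (MeasurableEquiv.subRight r).measurableEmbedding).2 hi
  have := h1.integrable_smul_left_of_hasCompactSupport (continuous_dirLaplacian hg 1)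
    (hasCompactSupport_dirLaplacian hc 1)
  simpa [mul_comm] using this

theorem integral_log_norm_sub_mul_dirLaplacian {g : ℂ → ℝ} (hg : ContDiff ℝ ∞ g)
    (hc : HasCompactSupport g) (r : ℂ) :
    ∫ t, Real.log ‖t - r‖ * dirLaplacian 1 g t = 2 * Real.pi * g r := by
  have hg' : ContDiff ℝ ∞ fun t => g (r + t) := hg.comp (contDiff_const.add contDiff_id)
  have hc' : HasCompactSupport fun t => g (r + t) := hc.comp_homeomorph (Homeomorph.addLeft r)
  have h := integral_log_norm_mul_dirLaplacian_zero hg' hc'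
  rw [add_zero] at h
  rw [← h, ← integral_add_left_eq_self _ r]
  refine integral_congr_ae (Eventually.of_forall fun t => ?_)
  have := dirLaplacian_comp_line hg 1 r t
  simp only [smul_eq_mul, mul_one] at this
  simp only [this, add_sub_cancel_left]

/-- The one-variable Poincaré–Lelong formula for a polynomial. -/
theorem integral_log_norm_eval_mul_dirLaplacian {f : ℂ[X]} (hf : f ≠ 0) {g : ℂ → ℝ}
    (hg : ContDiff ℝ ∞ g) (hc : HasCompactSupport g) :
    ∫ t, Real.log ‖f.eval t‖ * dirLaplacian 1 g t = 2 * Real.pi * (f.roots.map g).sum := by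
  have hΔi : Integrable (dirLaplacian 1 g) :=
    (continuous_dirLaplacian hg 1).integrable_of_hasCompactSupport
      (hasCompactSupport_dirLaplacian hc 1)
  have key : ∀ s : Multiset ℂ,
      Integrable (fun t => (s.map fun r => Real.log ‖t - r‖).sum * dirLaplacian 1 g t) ∧
      ∫ t, (s.map fun r => Real.log ‖t - r‖).sum * dirLaplacian 1 g t
        = 2 * Real.pi * (s.map g).sum := by
    intro s
    induction s using Multiset.induction_on with
    | empty => simp
    | cons r s ih =>
      have h1 := integrable_log_norm_sub_mul_dirLaplacian hg hc r
      simp only [Multiset.map_cons, Multiset.sum_cons, add_mul]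
      refine ⟨h1.add ih.1, ?_⟩
      rw [integral_add h1 ih.1, ih.2, integral_log_norm_sub_mul_dirLaplacian hg hc]
      ring
  have hae : ∀ᵐ t : ℂ, Real.log ‖f.eval t‖ * dirLaplacian 1 g t
      = Real.log ‖f.leadingCoeff‖ * dirLaplacian 1 g t
        + (f.roots.map fun r => Real.log ‖t - r‖).sum * dirLaplacian 1 g t := by
    filter_upwards [(Polynomial.finite_setOfPred_isRoot hf).countable.ae_notMem volume] with t ht
    have hsp := (IsAlgClosed.splits f).eq_prod_roots
    have h1 : f.eval t = f.leadingCoeff * (f.roots.map fun r => t - r).prod := by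
      conv_lhs => rw [hsp]
      simp [eval_multiset_prod, Multiset.map_map]
    have h2 : ∀ s : Multiset ℂ, t ∉ s → Real.log ‖(s.map fun r => t - r).prod‖
        = (s.map fun r => Real.log ‖t - r‖).sum ∧ (s.map fun r => t - r).prod ≠ 0 := by
      intro s
      induction s using Multiset.induction_on with
      | empty => simp
      | cons r s ih =>
        intro hs
        simp only [Multiset.mem_cons, not_or] at hs
        obtain ⟨ih1, ih2⟩ := ih hs.2
        simp only [Multiset.map_cons, Multiset.prod_cons, Multiset.sum_cons]
        refine ⟨?_, mul_ne_zero (sub_ne_zero.mpr hs.1) ih2⟩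
        rw [norm_mul, Real.log_mul (by simpa [sub_eq_zero] using hs.1) (by simpa using ih2), ih1]
    obtain ⟨h3, h4⟩ := h2 f.roots (by simpa [hf] using ht)
    rw [h1, norm_mul, Real.log_mul (by simpa using hf) (by simpa using h4), h3, add_mul]
  rw [integral_congr_ae hae, integral_add (hΔi.const_mul _) (key _).1, (key _).2,
    integral_const_mul, integral_dirLaplacian_eq_zero hg hc]
  ring

/-! ### The area formula for maps with countably many injective branches -/

/-- The function `h` on `B`, transported to `F '' B` by the map `F`, and extended by zero. -/
noncomputable def transport {α β : Type*} [Nonempty α] (F : α → β) (B : Set α) (h : α → ℝ) :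
    β → ℝ :=
  (F '' B).indicator fun y => h (Function.invFunOn F B y)

theorem transport_apply {α β : Type*} [Nonempty α] {F : α → β} {B : Set α} (hinj : InjOn F B)
    (h : α → ℝ) {w : α} (hw : w ∈ B) : transport F B h (F w) = h w := by
  rw [transport, indicator_of_mem (mem_image_of_mem F hw), hinj.leftInvOn_invFunOn hw]

section Area

variable {E : Type*} [NormedAddCommGroup E] [NormedSpace ℝ E] [FiniteDimensional ℝ E]
  [MeasurableSpace E] [BorelSpace E]

/-- The part of a measurable set where a differentiable map has an invertible derivative splits
into countably many measurable pieces on which the map is injective. -/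
theorem exists_injOn_pieces {F : E → E} {S : Set E} (hS : MeasurableSet S)
    (hF : ∀ x ∈ S, DifferentiableAt ℝ F x) :
    ∃ T : ℕ → Set E, (∀ j, MeasurableSet (T j)) ∧ Pairwise (Function.onFun Disjoint T) ∧
      ⋃ j, T j = S ∩ {x | (fderiv ℝ F x).det ≠ 0} ∧ ∀ j, InjOn F (T j) := by
  classical
  set S' := S ∩ {x | (fderiv ℝ F x).det ≠ 0} with hS'
  have hm : MeasurableSet S' := by
    refine hS.inter ?_
    exact (ContinuousLinearMap.continuous_det.measurable.comp (measurable_fderiv ℝ F))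
      (measurableSet_singleton (0 : ℝ)).compl
  let r : (E →L[ℝ] E) → NNReal := fun A =>
    if h : A.det ≠ 0 then
      (if Subsingleton E then 1 else
        ‖((A.toContinuousLinearEquivOfDetNeZero h).symm : E →L[ℝ] E)‖₊⁻¹ / 2)
    else 1
  have hr : ∀ A, r A ≠ 0 := by
    intro A
    simp only [r]
    split_ifs with h hs
    · exact one_ne_zero
    · have hN : Nontrivial E := not_subsingleton_iff_nontrivial.mp hs
      have h1 := (A.toContinuousLinearEquivOfDetNeZero h).symm.norm_pos
      have h2 : ‖((A.toContinuousLinearEquivOfDetNeZero h).symm : E →L[ℝ] E)‖₊ ≠ 0 := by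
        rw [← NNReal.coe_ne_zero]
        exact h1.ne'
      simpa using h2
    · exact one_ne_zero
  obtain ⟨t, A, htd, htm, hcov, happ, hA⟩ :=
    exists_partition_approximatesLinearOn_of_hasFDerivWithinAt F S' (fderiv ℝ F)
      (fun x hx => (hF x hx.1).hasFDerivAt.hasFDerivWithinAt) r hr
  refine ⟨fun j => S' ∩ t j, fun j => hm.inter (htm j), fun i j hij => ?_, ?_, fun j => ?_⟩
  · exact (htd hij).mono inter_subset_right inter_subset_right
  · rw [← inter_iUnion, inter_eq_left.mpr hcov]
  · rcases S'.eq_empty_or_nonempty with he | hne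
    · simp [he]
    obtain ⟨y, hy, hAy⟩ := hA hne j
    have hdet : (A j).det ≠ 0 := by rw [hAy]; exact hy.2
    have happj := happ j
    have : (A j) = ((A j).toContinuousLinearEquivOfDetNeZero hdet : E →L[ℝ] E) := by
      ext x; rfl
    by_cases hs : Subsingleton E
    · exact fun a _ b _ _ => Subsingleton.elim a b
    have hN : Nontrivial E := not_subsingleton_iff_nontrivial.mp hs
    refine ApproximatesLinearOn.injOn (f' := (A j).toContinuousLinearEquivOfDetNeZero hdet)
      (c := r (A j)) (by rw [← this]; exact happj) (Or.inr ?_)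
    simp only [r, dif_pos hdet, if_neg hs]
    have h1 := ((A j).toContinuousLinearEquivOfDetNeZero hdet).symm.norm_pos
    refine NNReal.half_lt_self ?_
    rw [← NNReal.coe_ne_zero]
    simpa using h1.ne'

/-- Change of variables for countably many injective maps, under the assumption that the
transported functions have a finite total integral. -/
theorem hasSum_integral_transport (μ : Measure E) [μ.IsAddHaarMeasure] {ι : Type*} [Countable ι]
    {F : ι → E → E} {B : ι → Set E} {h : ι → E → ℝ} (hB : ∀ p, MeasurableSet (B p))
    (hF : ∀ p, ∀ x ∈ B p, DifferentiableAt ℝ (F p) x) (hinj : ∀ p, InjOn (F p) (B p))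
    (hh : ∀ p, AEStronglyMeasurable (h p) (μ.restrict (B p)))
    (hfin : ∫⁻ y, ∑' p, ‖transport (F p) (B p) (h p) y‖ₑ ∂μ ≠ ⊤) :
    (∀ p, IntegrableOn (fun x => |(fderiv ℝ (F p) x).det| • h p x) (B p) μ) ∧
    (Summable fun p => ∫ x in B p, ‖|(fderiv ℝ (F p) x).det| • h p x‖ ∂μ) ∧
    HasSum (fun p => ∫ x in B p, |(fderiv ℝ (F p) x).det| • h p x ∂μ)
      (∫ y, ∑' p, transport (F p) (B p) (h p) y ∂μ) := by
  have hF' : ∀ p, ∀ x ∈ B p, HasFDerivWithinAt (F p) (fderiv ℝ (F p) x) (B p) x := fun p x hx =>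
    (hF p x hx).hasFDerivAt.hasFDerivWithinAt
  have himg : ∀ p, MeasurableSet (F p '' B p) := fun p =>
    measurable_image_of_fderivWithin (hB p) (hF' p) (hinj p)
  have hsrc : ∀ p, ∫⁻ x in B p, ‖|(fderiv ℝ (F p) x).det| • h p x‖ₑ ∂μ
      = ∫⁻ y, ‖transport (F p) (B p) (h p) y‖ₑ ∂μ := by
    intro p
    have h1 : ∀ y, ‖transport (F p) (B p) (h p) y‖ₑ
        = (F p '' B p).indicator (fun y => ‖h p (Function.invFunOn (F p) (B p) y)‖ₑ) y := by
      intro y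
      rw [transport, enorm_indicator_eq_indicator_enorm]
    simp only [h1]
    rw [lintegral_indicator (himg p), lintegral_image_eq_lintegral_abs_det_fderiv_mul μ (hB p)
      (hF' p) (hinj p)]
    refine setLIntegral_congr_fun (hB p) fun x hx => ?_
    simp only [enorm_smul, (hinj p).leftInvOn_invFunOn hx]
    rw [Real.enorm_abs, ← ofReal_norm, Real.norm_eq_abs]
  have hle : ∀ p, ∫⁻ y, ‖transport (F p) (B p) (h p) y‖ₑ ∂μ ≠ ⊤ := fun p =>
    ne_top_of_le_ne_top hfin (lintegral_mono fun y => ENNReal.le_tsum p)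
  have hint : ∀ p, IntegrableOn (fun x => |(fderiv ℝ (F p) x).det| • h p x) (B p) μ := by
    intro p
    have hJ : AEStronglyMeasurable (fun x => |(fderiv ℝ (F p) x).det|) (μ.restrict (B p)) :=
      ((ContinuousLinearMap.continuous_det.measurable.comp
        (measurable_fderiv ℝ (F p))).norm).aestronglyMeasurable
    refine ⟨hJ.smul (hh p), ?_⟩
    · rw [HasFiniteIntegral, hsrc p]
      exact (hle p).lt_top
  have hcongr : ∀ p, EqOn (fun x => |(fderiv ℝ (F p) x).det| • h p x)
      (fun x => |(fderiv ℝ (F p) x).det| • h p (Function.invFunOn (F p) (B p) (F p x))) (B p) := by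
    intro p x hx
    simp only [(hinj p).leftInvOn_invFunOn hx]
  have htr : ∀ p, Integrable (transport (F p) (B p) (h p)) μ := by
    intro p
    rw [transport, integrable_indicator_iff (himg p),
      integrableOn_image_iff_integrableOn_abs_det_fderiv_smul μ (hB p) (hF' p) (hinj p)]
    exact (hint p).congr_fun (hcongr p) (hB p)
  have hval : ∀ p, ∫ y, transport (F p) (B p) (h p) y ∂μ
      = ∫ x in B p, |(fderiv ℝ (F p) x).det| • h p x ∂μ := by
    intro p
    rw [transport, integral_indicator (himg p),
      integral_image_eq_integral_abs_det_fderiv_smul μ (hB p) (hF' p) (hinj p)]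
    exact (setIntegral_congr_fun (hB p) (hcongr p)).symm
  have hsum0 : ∑' p, ∫⁻ y, ‖transport (F p) (B p) (h p) y‖ₑ ∂μ ≠ ⊤ := by
    rw [← lintegral_tsum fun p => (htr p).1.enorm]
    exact hfin
  have hsum := ENNReal.summable_toReal hsum0
  refine ⟨hint, ?_, ?_⟩
  · refine hsum.congr fun p => ?_
    rw [integral_norm_eq_lintegral_enorm (hint p).1, hsrc p]
  · simp only [← hval]
    refine hasSum_integral_of_summable_integral_norm htr (hsum.congr fun p => ?_)
    rw [integral_norm_eq_lintegral_enorm (htr p).1]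

end Area

theorem det_fderiv_real_nonneg {k : ℕ} {F : (Fin k → ℂ) → Fin k → ℂ} {w : Fin k → ℂ}
    (hF : DifferentiableAt ℂ F w) : 0 ≤ (fderiv ℝ F w).det := by
  rw [hF.fderiv_restrictScalars ℝ]
  have : (ContinuousLinearMap.restrictScalars ℝ (fderiv ℂ F w)).det
      = Algebra.norm ℝ (LinearMap.det (fderiv ℂ F w : (Fin k → ℂ) →ₗ[ℂ] (Fin k → ℂ))) :=
    LinearMap.det_restrictScalars
  rw [this, Algebra.norm_complex_apply]
  exact Complex.normSq_nonneg _

/-- The integral over a complex manifold `M` of `g` times the pull-back of the volume form under a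
linear projection `π` is computed by summing `g` over the fibres of `π`. -/
theorem hasSum_integral_chartDecomposition {m : ℕ} {M : Set (Fin m → ℂ)} (𝒟 : ChartDecomposition M)
    (π : (Fin m → ℂ) →L[ℂ] (Fin (m - 1) → ℂ)) {g : (Fin m → ℂ) → ℝ} (hg : Continuous g)
    (hc : HasCompactSupport g) (n : ℕ)
    (hfin : ∀ᵐ y, (M ∩ π ⁻¹' {y}).Finite ∧ (M ∩ π ⁻¹' {y}).ncard ≤ n) :
    (∀ i, IntegrableOn (fun w => (fderiv ℝ (π ∘ 𝒟.ψ i) w).det * g (𝒟.ψ i w)) (𝒟.B i)) ∧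
    HasSum (fun i => ∫ w in 𝒟.B i, (fderiv ℝ (π ∘ 𝒟.ψ i) w).det * g (𝒟.ψ i w))
      (∫ y, ∑' z : ↥(M ∩ π ⁻¹' {y}), g z) := by
  set F : ℕ → (Fin (m - 1) → ℂ) → Fin (m - 1) → ℂ := fun i => π ∘ 𝒟.ψ i with hFdef
  have hψd : ∀ i, ∀ w ∈ 𝒟.W i, DifferentiableAt ℂ (𝒟.ψ i) w := fun i w hw =>
    (𝒟.isLocalParam i).2.1.differentiableAt ((𝒟.isLocalParam i).1.mem_nhds hw)
  have hFd : ∀ i, ∀ w ∈ 𝒟.W i, DifferentiableAt ℂ (F i) w := fun i w hw =>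
    π.differentiableAt.comp w (hψd i w hw)
  have hFdR : ∀ i, ∀ w ∈ 𝒟.B i, DifferentiableAt ℝ (F i) w := fun i w hw =>
    (hFd i w (𝒟.subset i hw)).restrictScalars ℝ
  have hψinj : ∀ i, InjOn (𝒟.ψ i) (𝒟.W i) := fun i =>
    Set.injOn_iff_injective.mpr (𝒟.isLocalParam i).2.2.2.1.injective
  choose T hTm hTd hTu hTi using fun i => exists_injOn_pieces (𝒟.measurable i) (hFdR i)
  have hTsub : ∀ i j, T i j ⊆ 𝒟.B i ∩ {x | (fderiv ℝ (F i) x).det ≠ 0} := fun i j => by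
    rw [← hTu i]; exact subset_iUnion _ j
  have hgψ : ∀ i, ContinuousOn (fun w => g (𝒟.ψ i w)) (𝒟.W i) := fun i =>
    hg.comp_continuousOn fun w hw => (hψd i w hw).continuousAt.continuousWithinAt
  obtain ⟨C, hC⟩ := hc.exists_bound_of_continuous hg
  have hK : IsCompact (π '' tsupport g) := hc.isCompact.image π.continuous
  -- almost every fibre misses the critical values
  have hcrit : ∀ᵐ y : Fin (m - 1) → ℂ, ∀ i,
      y ∉ F i '' (𝒟.B i ∩ {x | (fderiv ℝ (F i) x).det = 0}) := by
    rw [ae_all_iff]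
    intro i
    rw [ae_iff]
    simp only [not_not, ofPred_mem_eq]
    exact addHaar_image_eq_zero_of_det_fderivWithin_eq_zero volume
      (f' := fderiv ℝ (F i)) (fun x hx => (hFdR i x hx.1).hasFDerivAt.hasFDerivWithinAt)
      (fun x hx => hx.2)
  -- the points of such a fibre correspond to the branches defined there
  have hfib : ∀ {A : Type} [AddCommMonoid A] [TopologicalSpace A] (v : ℝ → A), v 0 = 0 →
      ∀ y, (∀ i, y ∉ F i '' (𝒟.B i ∩ {x | (fderiv ℝ (F i) x).det = 0})) →
      ∀ a : A, HasSum (fun z : ↥(M ∩ π ⁻¹' {y}) => v (g z)) a →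
        HasSum (fun p : ℕ × ℕ =>
          v (transport (F p.1) (T p.1 p.2) (fun w => g (𝒟.ψ p.1 w)) y)) a := by
    intro A _ _ v hv0 y hy a ha
    have hex : ∀ z : ↥(M ∩ π ⁻¹' {y}), ∃ p : ℕ × ℕ, ∃ w ∈ T p.1 p.2, 𝒟.ψ p.1 w = z := by
      rintro ⟨z, hzM, hzy⟩
      rw [← 𝒟.cover] at hzM
      obtain ⟨i, w, hw, rfl⟩ := mem_iUnion.mp hzM
      have hdet : (fderiv ℝ (F i) w).det ≠ 0 := fun h0 => hy i ⟨w, ⟨hw, h0⟩, hzy⟩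
      have : w ∈ ⋃ j, T i j := by rw [hTu i]; exact ⟨hw, hdet⟩
      obtain ⟨j, hj⟩ := mem_iUnion.mp this
      exact ⟨(i, j), w, hj, rfl⟩
    choose σ pt hpt hptz using hex
    have hFpt : ∀ z : ↥(M ∩ π ⁻¹' {y}), F (σ z).1 (pt z) = y := fun z => by
      simp only [hFdef, Function.comp_apply, hptz]
      exact z.2.2
    have hσ : Function.Injective σ := by
      intro z z' hzz
      have h1 := hFpt z
      have h2 := hFpt z'
      have h3 := hpt z
      rw [hzz] at h1 h3
      have h4 : pt z = pt z' := hTi _ _ h3 (hpt z') (h1.trans h2.symm)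
      ext1
      rw [← hptz z, ← hptz z', h4, hzz]
    have hzero : ∀ p ∉ range σ,
        v (transport (F p.1) (T p.1 p.2) (fun w => g (𝒟.ψ p.1 w)) y) = 0 := by
      intro p hp
      rw [transport, indicator_of_notMem, hv0]
      rintro ⟨w, hw, hwy⟩
      have hwB : w ∈ 𝒟.B p.1 := (hTsub _ _ hw).1
      have hzM : 𝒟.ψ p.1 w ∈ M := 𝒟.cover.subset (mem_iUnion.mpr ⟨p.1, w, hwB, rfl⟩)
      let z : ↥(M ∩ π ⁻¹' {y}) := ⟨𝒟.ψ p.1 w, hzM, hwy⟩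
      refine hp ⟨z, ?_⟩
      have hz : 𝒟.ψ (σ z).1 (pt z) = 𝒟.ψ p.1 w := hptz z
      have h1 : (σ z).1 = p.1 := by
        by_contra hne
        refine Set.disjoint_left.mp (𝒟.disjoint hne) ⟨pt z, (hTsub _ _ (hpt z)).1, rfl⟩ ?_
        exact ⟨w, hwB, hz.symm⟩
      have h2 : pt z = w := by
        have h3 := (hTsub _ _ (hpt z)).1
        rw [h1] at hz h3
        exact hψinj p.1 (𝒟.subset _ h3) (𝒟.subset _ hwB) hz
      refine Prod.ext h1 ?_
      by_contra hne
      have h4 := hpt z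
      rw [h1, h2] at h4
      exact Set.disjoint_left.mp (hTd p.1 hne) h4 hw
    refine (hσ.hasSum_iff hzero).mp ?_
    convert! ha using 2 with z
    simp only [Function.comp_apply]
    congr 1
    have := transport_apply (hTi (σ z).1 (σ z).2) (fun w => g (𝒟.ψ (σ z).1 w)) (hpt z)
    rw [hFpt] at this
    rw [this, hptz]
  have hbound : ∀ᵐ y, ∑' p : ℕ × ℕ,
      ‖transport (F p.1) (T p.1 p.2) (fun w => g (𝒟.ψ p.1 w)) y‖ₑ
        ≤ (π '' tsupport g).indicator (fun _ => (n : ENNReal) * ENNReal.ofReal C) y := by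
    filter_upwards [hcrit, hfin] with y hy hyfin
    have hF0 := hyfin.1.to_subtype
    have hFt := Fintype.ofFinite ↥(M ∩ π ⁻¹' {y})
    have h1 := hfib (fun x : ℝ => ‖x‖ₑ) (by simp) y hy _ (hasSum_fintype _)
    rw [h1.tsum_eq]
    by_cases hyK : y ∈ π '' tsupport g
    · rw [indicator_of_mem hyK]
      calc ∑ z : ↥(M ∩ π ⁻¹' {y}), ‖g z‖ₑ
          ≤ ∑ _z : ↥(M ∩ π ⁻¹' {y}), ENNReal.ofReal C := by
            refine Finset.sum_le_sum fun z _ => ?_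
            rw [← ofReal_norm]
            exact ENNReal.ofReal_le_ofReal (hC z)
        _ ≤ (n : ENNReal) * ENNReal.ofReal C := by
            rw [Finset.sum_const, nsmul_eq_mul]
            refine mul_le_mul_left (Nat.cast_le.mpr ?_) _
            rw [Finset.card_univ, ← Nat.card_eq_fintype_card]
            exact hyfin.2
    · rw [indicator_of_notMem hyK]
      refine (Finset.sum_eq_zero fun z _ => ?_).le
      have : g z = 0 := image_eq_zero_of_notMem_tsupport fun hz => hyK ⟨z, hz, z.2.2⟩
      simp [this]
  have hne : ∫⁻ y, ∑' p : ℕ × ℕ,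
      ‖transport (F p.1) (T p.1 p.2) (fun w => g (𝒟.ψ p.1 w)) y‖ₑ ≠ ⊤ := by
    refine ne_top_of_le_ne_top ?_ (lintegral_mono_ae hbound)
    rw [lintegral_indicator hK.measurableSet, lintegral_const]
    refine ENNReal.mul_ne_top (ENNReal.mul_ne_top (by simp) (by simp)) ?_
    simpa using hK.measure_lt_top.ne
  obtain ⟨hI, hS, hHS⟩ := hasSum_integral_transport (volume : Measure (Fin (m - 1) → ℂ))
    (ι := ℕ × ℕ) (F := fun p => F p.1) (B := fun p => T p.1 p.2)
    (h := fun p w => g (𝒟.ψ p.1 w)) (fun p => hTm _ _)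
    (fun p x hx => hFdR _ x (hTsub _ _ hx).1) (fun p => hTi _ _)
    (fun p => ((hgψ p.1).mono fun x hx => 𝒟.subset _ (hTsub _ _ hx).1).aestronglyMeasurable
      (hTm _ _)) hne
  have habs : ∀ i, ∀ w ∈ 𝒟.B i, |(fderiv ℝ (F i) w).det| = (fderiv ℝ (F i) w).det :=
    fun i w hw => abs_of_nonneg (det_fderiv_real_nonneg (hFd i w (𝒟.subset _ hw)))
  have hcongr : ∀ i j, EqOn (fun w => |(fderiv ℝ (F i) w).det| • g (𝒟.ψ i w))
      (fun w => (fderiv ℝ (F i) w).det * g (𝒟.ψ i w)) (T i j) := fun i j w hw => by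
    simp only [habs i w (hTsub i j hw).1, smul_eq_mul]
  have hdiff : ∀ i, ∀ w ∈ 𝒟.B i \ ⋃ j, T i j, (fderiv ℝ (F i) w).det * g (𝒟.ψ i w) = 0 := by
    intro i w hw
    rw [hTu i] at hw
    have : (fderiv ℝ (F i) w).det = 0 := by
      by_contra h0
      exact hw.2 ⟨hw.1, h0⟩
    rw [this, zero_mul]
  have hIU : ∀ i, IntegrableOn (fun w => (fderiv ℝ (F i) w).det * g (𝒟.ψ i w)) (⋃ j, T i j) := by
    intro i
    refine integrableOn_iUnion_of_summable_integral_norm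
      (fun j => (hI (i, j)).congr_fun (hcongr i j) (hTm i j)) ?_
    refine (hS.comp_injective (Prod.mk_right_injective i)).congr fun j => ?_
    refine setIntegral_congr_fun (hTm i j) fun w hw => ?_
    simp only [hcongr i j hw]
  refine ⟨fun i => (hIU i).of_forall_sdiff_eq_zero (𝒟.measurable i) (hdiff i), ?_⟩
  have hval : ∫ y, ∑' p : ℕ × ℕ, transport (F p.1) (T p.1 p.2) (fun w => g (𝒟.ψ p.1 w)) y
      = ∫ y, ∑' z : ↥(M ∩ π ⁻¹' {y}), g z := by
    refine integral_congr_ae ?_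
    filter_upwards [hcrit, hfin] with y hy hyfin
    have hF0 := hyfin.1.to_subtype
    have hFt := Fintype.ofFinite ↥(M ∩ π ⁻¹' {y})
    exact (hfib (fun x : ℝ => x) rfl y hy _ (Summable.of_finite).hasSum).tsum_eq
  rw [← hval]
  refine hHS.prod_fiberwise fun i => ?_
  rw [setIntegral_eq_of_subset_of_forall_sdiff_eq_zero (𝒟.measurable i)
    (by rw [hTu i]; exact inter_subset_left) (hdiff i)]
  refine (hasSum_integral_iUnion (hTm i) (hTd i) (hIU i)).congr_fun ?_
  intro j
  exact setIntegral_congr_fun (hTm i j) (hcongr i j)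

/-! ### Regular points of a hypersurface -/

theorem contDiff_eval {m : ℕ} (f : MvPolynomial (Fin m) ℂ) :
    ContDiff ℂ ω fun z : Fin m → ℂ => MvPolynomial.eval z f := by
  have h : AnalyticOnNhd ℂ (fun z : Fin m → ℂ => MvPolynomial.eval z f) univ :=
    AnalyticOnNhd.eval_continuousLinearMap (ContinuousLinearMap.id ℂ (Fin m → ℂ)) f
  exact contDiffOn_univ.mp (h.contDiffOn uniqueDiffOn_univ)

/-- A zero of `f` that is a simple zero on a complex line is a regular point of the zero set:
by the inverse function theorem the zero set is near it a graph over the complement of the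
line. -/
theorem mem_regularPoints_of_fderiv_ne_zero {m : ℕ} {f : MvPolynomial (Fin m) ℂ}
    (L : (ℂ × (Fin (m - 1) → ℂ)) ≃L[ℂ] (Fin m → ℂ)) {z : Fin m → ℂ}
    (hz : MvPolynomial.eval z f = 0)
    (hd : fderiv ℂ (fun z : Fin m → ℂ => MvPolynomial.eval z f) z (L (1, 0)) ≠ 0) :
    z ∈ regularPoints (zeroSet f) := by
  set F : (Fin m → ℂ) → ℂ := fun z => MvPolynomial.eval z f with hF
  have hFc : ContDiff ℂ ω F := contDiff_eval f
  set Φ : ℂ × (Fin (m - 1) → ℂ) → ℂ × (Fin (m - 1) → ℂ) := fun p => (F (L p), p.2) with hΦ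
  have hΦc : ContDiff ℂ ω Φ := (hFc.comp L.contDiff).prodMk contDiff_snd
  have hΦd : ∀ p, HasFDerivAt Φ (((fderiv ℂ F (L p)).comp
      (L : (ℂ × (Fin (m - 1) → ℂ)) →L[ℂ] (Fin m → ℂ))).prod
      (ContinuousLinearMap.snd ℂ ℂ (Fin (m - 1) → ℂ))) p := by
    intro p
    have h1 : HasFDerivAt F (fderiv ℂ F (L p)) (L p) :=
      (hFc.differentiable (by simp) _).hasFDerivAt
    exact (h1.comp p L.hasFDerivAt).prodMk hasFDerivAt_snd
  have hequiv : ∀ p, fderiv ℂ F (L p) (L (1, 0)) ≠ 0 →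
      ∃ e : (ℂ × (Fin (m - 1) → ℂ)) ≃L[ℂ] (ℂ × (Fin (m - 1) → ℂ)),
        HasFDerivAt Φ (e : (ℂ × (Fin (m - 1) → ℂ)) →L[ℂ] (ℂ × (Fin (m - 1) → ℂ))) p := by
    intro p hp
    have hinj : Function.Injective (((fderiv ℂ F (L p)).comp
      (L : (ℂ × (Fin (m - 1) → ℂ)) →L[ℂ] (Fin m → ℂ))).prod
      (ContinuousLinearMap.snd ℂ ℂ (Fin (m - 1) → ℂ)) :
        (ℂ × (Fin (m - 1) → ℂ)) →ₗ[ℂ] (ℂ × (Fin (m - 1) → ℂ))) := by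
      rw [injective_iff_map_eq_zero]
      rintro ⟨t, y⟩ h
      have h2 : y = 0 := congrArg Prod.snd h
      have h1 : fderiv ℂ F (L p) (L (t, y)) = 0 := congrArg Prod.fst h
      subst h2
      have h3 : ((t, 0) : ℂ × (Fin (m - 1) → ℂ)) = t • (1, 0) := by simp
      rw [h3, map_smul, map_smul, smul_eq_mul, mul_eq_zero] at h1
      rw [h1.resolve_right hp]
      rfl
    refine ⟨(LinearEquiv.ofInjectiveEndo _ hinj).toContinuousLinearEquiv, ?_⟩
    exact (hΦd p).congr_fderiv (ContinuousLinearMap.ext fun v => rfl)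
  set p₀ := L.symm z with hp₀
  have hLp₀ : L p₀ = z := L.apply_symm_apply z
  obtain ⟨e₀, he₀⟩ := hequiv p₀ (by rw [hLp₀]; exact hd)
  set S : Set (ℂ × (Fin (m - 1) → ℂ)) := {p | fderiv ℂ F (L p) (L (1, 0)) ≠ 0} with hS
  have hSo : IsOpen S := by
    have : Continuous fun p => fderiv ℂ F (L p) (L (1, 0)) :=
      ((hFc.continuous_fderiv (by simp)).comp L.continuous).clm_apply continuous_const
    exact isOpen_ne.preimage this
  set H := (hΦc.contDiffAt (x := p₀)).toOpenPartialHomeomorph Φ he₀ (by simp) with hH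
  set G := H.restrOpen S hSo with hG
  have hGcoe : ∀ p, G p = Φ p := fun p => rfl
  have hsrc : G.source = H.source ∩ S := rfl
  have hp₀G : p₀ ∈ G.source := by
    refine ⟨ContDiffAt.mem_toOpenPartialHomeomorph_source _ he₀ (by simp), ?_⟩
    change fderiv ℂ F (L p₀) (L (1, 0)) ≠ 0
    rw [hLp₀]; exact hd
  set W : Set (Fin (m - 1) → ℂ) := {y | ((0 : ℂ), y) ∈ G.target} with hW
  set ψ : (Fin (m - 1) → ℂ) → Fin m → ℂ := fun y => L (G.symm (0, y)) with hψ
  have hWo : IsOpen W := G.open_target.preimage (by fun_prop)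
  have hΦψ : ∀ y ∈ W, Φ (G.symm (0, y)) = (0, y) := fun y hy => G.right_inv hy
  have hπψ : ∀ y ∈ W, (L.symm (ψ y)).2 = y := fun y hy => by
    simp only [hψ, L.symm_apply_apply]
    exact congrArg Prod.snd (hΦψ y hy)
  have hψd : ∀ y ∈ W, DifferentiableAt ℂ ψ y := by
    intro y hy
    have hmem : G.symm (0, y) ∈ G.source := G.map_target hy
    obtain ⟨e, he⟩ := hequiv _ hmem.2
    have h1 : ContDiffAt ℂ ω G.symm (0, y) := G.contDiffAt_symm hy he hΦc.contDiffAt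
    have h2 : DifferentiableAt ℂ G.symm (0, y) := h1.differentiableAt (by simp)
    have h3 : DifferentiableAt ℂ (fun y : Fin (m - 1) → ℂ => ((0 : ℂ), y)) y := by fun_prop
    have h4 : DifferentiableAt ℂ (fun y => G.symm (0, y)) y := DifferentiableAt.comp y h2 h3
    exact L.differentiableAt.comp y h4
  refine ⟨W, ψ, ⟨hWo, fun y hy => (hψd y hy).differentiableWithinAt, fun y hy => ?_, ?_,
    L.symm ⁻¹' G.source, G.open_source.preimage L.symm.continuous, ?_⟩, ?_⟩
  · -- the projection is a left inverse of `ψ`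
    have h1 : HasFDerivAt (fun w => (L.symm (ψ w)).2)
        (((ContinuousLinearMap.snd ℂ ℂ (Fin (m - 1) → ℂ)).comp
          (L.symm : (Fin m → ℂ) →L[ℂ] _)).comp (fderiv ℂ ψ y)) y := by
      have h := ((ContinuousLinearMap.snd ℂ ℂ (Fin (m - 1) → ℂ)).comp
          (L.symm : (Fin m → ℂ) →L[ℂ] _)).hasFDerivAt (x := ψ y)
      exact h.comp y (hψd y hy).hasFDerivAt
    have h2 : HasFDerivAt (fun w => (L.symm (ψ w)).2)
        (ContinuousLinearMap.id ℂ (Fin (m - 1) → ℂ)) y := by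
      refine (hasFDerivAt_id y).congr_of_eventuallyEq ?_
      filter_upwards [hWo.mem_nhds hy] with w hw
      exact hπψ w hw
    have h3 := h1.unique h2
    intro a b hab
    have ha := congrArg (fun A : (Fin (m - 1) → ℂ) →L[ℂ] (Fin (m - 1) → ℂ) => A a) h3
    have hb := congrArg (fun A : (Fin (m - 1) → ℂ) →L[ℂ] (Fin (m - 1) → ℂ) => A b) h3
    simp only [ContinuousLinearMap.comp_apply, hab, ContinuousLinearMap.id_apply] at ha hb
    exact ha.symm.trans hb
  · refine Topology.IsEmbedding.of_comp (g := fun x => (L.symm x).2) ?_ (by fun_prop) ?_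
    · exact continuousOn_iff_continuous_domRestrict.mp fun y hy =>
        (hψd y hy).continuousAt.continuousWithinAt
    · have : ((fun x => (L.symm x).2) ∘ W.domRestrict ψ) = Subtype.val := by
        ext1 y
        exact hπψ y y.2
      rw [this]
      exact Topology.IsEmbedding.subtypeVal
  · ext x
    constructor
    · rintro ⟨y, hy, rfl⟩
      refine ⟨congrArg Prod.fst (hΦψ y hy), ?_⟩
      simp only [hψ, mem_preimage, L.symm_apply_apply]
      exact G.map_target hy
    · rintro ⟨hx, hxs⟩
      have hx0 : F x = 0 := hx
      have h1 : Φ (L.symm x) = (0, (L.symm x).2) := by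
        simp only [hΦ, L.apply_symm_apply, hx0]
      have h2 : ((0 : ℂ), (L.symm x).2) ∈ G.target := by
        rw [← h1]; exact G.map_source hxs
      refine ⟨(L.symm x).2, h2, ?_⟩
      simp only [hψ]
      rw [← h1, ← hGcoe, G.left_inv hxs, L.apply_symm_apply]
  · have h1 : Φ p₀ = (0, p₀.2) := by
      simp only [hΦ, hLp₀]
      rw [show F z = 0 from hz]
    refine ⟨p₀.2, ?_, ?_⟩
    · change ((0 : ℂ), p₀.2) ∈ G.target
      rw [← h1]; exact G.map_source hp₀G
    · simp only [hψ]
      rw [← h1, ← hGcoe, G.left_inv hp₀G, hLp₀]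

theorem IsLocalParam.of_regularPoints {m : ℕ} {Z : Set (Fin m → ℂ)}
    {W : Set (Fin (m - 1) → ℂ)} {ψ : (Fin (m - 1) → ℂ) → Fin m → ℂ} (h : IsLocalParam Z W ψ) :
    IsLocalParam (regularPoints Z) W ψ := by
  obtain ⟨h1, h2, h3, h4, U, hU, hWU⟩ := h
  refine ⟨h1, h2, h3, h4, U, hU, subset_antisymm ?_ ?_⟩
  · exact fun x hx => ⟨⟨W, ψ, ⟨h1, h2, h3, h4, U, hU, hWU⟩, hx⟩, (hWU.subset hx).2⟩
  · rintro x ⟨⟨W', ψ', hp, hx⟩, hxU⟩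
    obtain ⟨-, -, -, -, U', -, hWU'⟩ := hp
    exact hWU.superset ⟨(hWU'.subset hx).1, hxU⟩

theorem regularPoints_subset {m : ℕ} (Z : Set (Fin m → ℂ)) : regularPoints Z ⊆ Z := by
  rintro x ⟨W, ψ, ⟨-, -, -, -, U, -, hWU⟩, hx⟩
  exact (hWU.subset hx).1

/-- By the Lindelöf property, the regular part of any set is covered by countably many charts;
these are cut down to disjoint pieces. -/
theorem nonempty_chartDecomposition {m : ℕ} (Z : Set (Fin m → ℂ)) :
    Nonempty (ChartDecomposition (regularPoints Z)) := by
  rcases (regularPoints Z).eq_empty_or_nonempty with he | ⟨x₀, hx₀⟩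
  · have : IsEmpty (↥(∅ : Set (Fin (m - 1) → ℂ))) := by simp
    refine ⟨⟨fun _ => ∅, fun _ _ => 0, fun _ => ∅, fun _ => ⟨isOpen_empty, by simp, by simp,
      .of_subsingleton _, ∅, isOpen_empty, by simp⟩, by simp, by simp, fun _ _ _ => by simp, ?_⟩⟩
    simp [he]
  have hex : ∀ z : regularPoints Z, ∃ (W : Set (Fin (m - 1) → ℂ))
      (ψ : (Fin (m - 1) → ℂ) → Fin m → ℂ) (U : Set (Fin m → ℂ)),
      IsLocalParam (regularPoints Z) W ψ ∧ IsOpen U ∧ ψ '' W = regularPoints Z ∩ U ∧ ↑z ∈ U := by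
    rintro ⟨z, W, ψ, hp, hz⟩
    obtain ⟨-, -, -, -, U, hU, hWU⟩ := hp.of_regularPoints
    exact ⟨W, ψ, U, hp.of_regularPoints, hU, hWU, (hWU.subset hz).2⟩
  choose W ψ U hp hU hWU hzU using hex
  obtain ⟨T, hTc, hTU⟩ := TopologicalSpace.isOpen_iUnion_countable U hU
  have hTne : T.Nonempty := by
    by_contra hne
    rw [not_nonempty_iff_eq_empty] at hne
    have : x₀ ∈ ⋃ i, U i := mem_iUnion.mpr ⟨⟨x₀, hx₀⟩, hzU _⟩
    rw [← hTU, hne] at this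
    simp at this
  obtain ⟨c, rfl⟩ := hTc.exists_eq_range hTne
  have hcover : ∀ z ∈ regularPoints Z, ∃ i, z ∈ U (c i) := by
    intro z hz
    have : z ∈ ⋃ i, U i := mem_iUnion.mpr ⟨⟨z, hz⟩, hzU _⟩
    rw [← hTU] at this
    simpa using this
  set V : ℕ → Set (Fin m → ℂ) := disjointed fun i => U (c i) with hV
  have hVU : ∀ i, V i ⊆ U (c i) := fun i => disjointed_subset _ i
  have himg : ∀ i, ψ (c i) '' (W (c i) ∩ ψ (c i) ⁻¹' V i) = regularPoints Z ∩ V i := by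
    intro i
    rw [image_inter_preimage, hWU, inter_assoc, inter_eq_right.mpr (hVU i)]
  refine ⟨⟨fun i => W (c i), fun i => ψ (c i), fun i => W (c i) ∩ ψ (c i) ⁻¹' V i,
    fun i => hp _, fun i => inter_subset_left, fun i => ?_, fun i j hij => ?_, ?_⟩⟩
  · have hVm : MeasurableSet (V i) := MeasurableSet.disjointed (fun i => (hU (c i)).measurableSet) i
    have hcont : ContinuousOn (ψ (c i)) (W (c i)) := (hp (c i)).2.1.continuousOn
    have h1 := (continuousOn_iff_continuous_domRestrict.mp hcont).measurable hVm
    have h2 := (hp (c i)).1.measurableSet.subtype_image h1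
    convert h2 using 1
    ext x
    simp [and_comm]
  · change Disjoint (ψ (c i) '' _) (ψ (c j) '' _)
    rw [himg, himg]
    exact (disjoint_disjointed _ hij).mono inter_subset_right inter_subset_right
  · simp only [himg]
    rw [← inter_iUnion, hV, iUnion_disjointed, inter_eq_left]
    intro z hz
    obtain ⟨i, hi⟩ := hcover z hz
    exact mem_iUnion.mpr ⟨i, hi⟩

/-! ### The Poincaré–Lelong formula for one projection -/

/-- Linear changes of variables multiply Lebesgue measure by a constant. -/
theorem exists_integral_comp_equiv {m k : ℕ} (L : (ℂ × (Fin k → ℂ)) ≃L[ℂ] (Fin m → ℂ)) :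
    ∃ c : ℝ, ∀ h : (Fin m → ℂ) → ℝ, Integrable h →
      Integrable (fun p => h (L p)) ∧ ∫ p, h (L p) = c * ∫ z, h z := by
  have hvol : (volume : Measure (ℂ × (Fin k → ℂ))).IsAddHaarMeasure :=
    Measure.prod.instIsAddHaarMeasure _ _
  have hL : ((volume : Measure (ℂ × (Fin k → ℂ))).map L).IsAddHaarMeasure :=
    L.isAddHaarMeasure_map _
  have hme : MeasurableEmbedding L := L.toHomeomorph.measurableEmbedding
  set c := ((volume : Measure (ℂ × (Fin k → ℂ))).map L).addHaarScalarFactor volume with hc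
  have hmap : (volume : Measure (ℂ × (Fin k → ℂ))).map L = c • (volume : Measure (Fin m → ℂ)) :=
    Measure.isAddLeftInvariant_eq_smul _ _
  refine ⟨c, fun h hh => ⟨?_, ?_⟩⟩
  · have : Integrable h ((volume : Measure (ℂ × (Fin k → ℂ))).map L) := by
      rw [hmap]
      exact hh.smul_measure_nnreal
    exact (hme.integrable_map_iff).mp this
  · rw [← hme.integral_map (μ := volume) h, hmap, integral_smul_nnreal_measure]
    rfl

theorem fderiv_eval_apply_eq {m : ℕ} (f : MvPolynomial (Fin m) ℂ) (u z₀ : Fin m → ℂ) (t : ℂ) :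
    fderiv ℂ (fun z : Fin m → ℂ => MvPolynomial.eval z f) (z₀ + t • u) u
      = (linePoly f u z₀).derivative.eval t := by
  have h1 : HasFDerivAt (fun z : Fin m → ℂ => MvPolynomial.eval z f)
      (fderiv ℂ (fun z : Fin m → ℂ => MvPolynomial.eval z f) (z₀ + t • u)) (z₀ + t • u) :=
    ((contDiff_eval f).differentiable (by simp) _).hasFDerivAt
  have h2 : HasDerivAt (fun t : ℂ => z₀ + t • u) u t := by
    simpa using ((hasDerivAt_id t).smul_const u).const_add z₀
  have h3 := h1.comp_hasDerivAt t h2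
  have h4 := (linePoly f u z₀).hasDerivAt t
  have h5 : ((fun z : Fin m → ℂ => MvPolynomial.eval z f) ∘ fun t : ℂ => z₀ + t • u)
      = fun t => (linePoly f u z₀).eval t := by
    ext t
    simp
  rw [h5] at h3
  exact h3.unique h4

/-- If `f` restricts to a separable polynomial on the line over `y`, then the points of the regular
part of its zero set over `y` are the roots of this polynomial. -/
theorem regularPoints_inter_fiber {m : ℕ} (f : MvPolynomial (Fin m) ℂ)
    (L : (ℂ × (Fin (m - 1) → ℂ)) ≃L[ℂ] (Fin m → ℂ)) {y : Fin (m - 1) → ℂ}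
    (hsep : (linePoly f (L (1, 0)) (L (0, y))).Separable) :
    regularPoints (zeroSet f) ∩ (fun z => (L.symm z).2) ⁻¹' {y}
      = (fun t : ℂ => L (0, y) + t • L (1, 0)) ''
          ((linePoly f (L (1, 0)) (L (0, y))).roots.toFinset : Set ℂ) := by
  have hline : ∀ t : ℂ, L (0, y) + t • L (1, 0) = L (t, y) := by
    intro t
    rw [← map_smul, ← map_add]
    simp
  have hne := hsep.ne_zero
  ext z
  constructor
  · rintro ⟨hz, hzy⟩
    have hzy' : (L.symm z).2 = y := hzy
    have h1 : L (0, y) + (L.symm z).1 • L (1, 0) = z := by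
      rw [hline, ← hzy', Prod.mk.eta, L.apply_symm_apply]
    refine ⟨(L.symm z).1, ?_, h1⟩
    have hz0 : MvPolynomial.eval z f = 0 := regularPoints_subset _ hz
    simp only [Finset.mem_coe, Multiset.mem_toFinset, mem_roots', IsRoot.def, eval_linePoly, h1]
    exact ⟨hne, hz0⟩
  · rintro ⟨t, ht, rfl⟩
    simp only [Finset.mem_coe, Multiset.mem_toFinset, mem_roots', IsRoot.def] at ht
    refine ⟨mem_regularPoints_of_fderiv_ne_zero L ?_ ?_, ?_⟩
    · rw [← eval_linePoly]; exact ht.2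
    · rw [fderiv_eval_apply_eq]
      intro h0
      have := hsep.eval₂_derivative_ne_zero (RingHom.id ℂ) (x := t)
        (by rw [eval₂_id]; exact ht.2)
      rw [eval₂_id] at this
      exact this h0
    · simp only [mem_preimage, hline, L.symm_apply_apply, mem_singleton_iff]

/-- The sum of a test function over a fibre of the regular part of the zero set is an integral
against `log |f|` over the corresponding complex line. -/
theorem tsum_fiber_eq {m : ℕ} (f : MvPolynomial (Fin m) ℂ)
    (L : (ℂ × (Fin (m - 1) → ℂ)) ≃L[ℂ] (Fin m → ℂ)) {y : Fin (m - 1) → ℂ}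
    (hsep : (linePoly f (L (1, 0)) (L (0, y))).Separable) {g : (Fin m → ℂ) → ℝ}
    (hg : ContDiff ℝ ∞ g) (hc : HasCompactSupport g) :
    ∑' z : ↥(regularPoints (zeroSet f) ∩ (fun z => (L.symm z).2) ⁻¹' {y}), g z
      = 1 / (2 * Real.pi) * ∫ t : ℂ, Real.log ‖MvPolynomial.eval (L (t, y)) f‖
          * dirLaplacian (L (1, 0)) g (L (t, y)) := by
  have hline : ∀ t : ℂ, L (t, y) = L (0, y) + t • L (1, 0) := by
    intro t
    rw [← map_smul, ← map_add]
    simp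
  have hinj : Function.Injective fun t : ℂ => L (0, y) + t • L (1, 0) := by
    intro t t' h
    simp only [← hline] at h
    exact congrArg Prod.fst (L.injective h)
  set u := L (1, 0)
  set z₀ := L (0, y)
  set q := linePoly f u z₀ with hq
  have hg' : ContDiff ℝ ∞ fun t : ℂ => g (z₀ + t • u) :=
    hg.comp (contDiff_const.add (contDiff_id.smul contDiff_const))
  have hemb : Topology.IsClosedEmbedding fun t : ℂ => L (t, y) :=
    L.toHomeomorph.isClosedEmbedding.comp
      (Topology.IsClosedEmbedding.of_continuous_injective_isClosedMap (by fun_prop)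
        (fun a b h => congrArg Prod.fst h) (isClosedMap_prodMk_right y))
  have hc' : HasCompactSupport fun t : ℂ => g (z₀ + t • u) := by
    have := hc.comp_isClosedEmbedding hemb
    simpa only [Function.comp_def, hline] using this
  have hPL := integral_log_norm_eval_mul_dirLaplacian hsep.ne_zero hg' hc'
  have hR : ∫ t : ℂ, Real.log ‖MvPolynomial.eval (L (t, y)) f‖ * dirLaplacian u g (L (t, y))
      = 2 * Real.pi * (q.roots.map fun t => g (z₀ + t • u)).sum := by
    rw [← hPL]
    refine integral_congr_ae (Eventually.of_forall fun t => ?_)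
    simp only [hq, eval_linePoly, dirLaplacian_comp_line hg, hline]
  rw [hR, regularPoints_inter_fiber f L hsep,
    tsum_image (g := fun t : ℂ => z₀ + t • u) g hinj.injOn,
    Finset.tsum_subtype' q.roots.toFinset fun t => g (z₀ + t • u), Finset.sum,
    Multiset.toFinset_val, (nodup_roots hsep).dedup]
  field_simp

/-- The Poincaré–Lelong formula, tested against `g` times the pull-back of the volume form of
`ℂ^(m-1)` under the projection along `L (1, 0)`: by the area formula and Fubini's theorem it is the
one-variable formula on the complex lines of direction `L (1, 0)`. -/
theorem exists_poincareLelong {m : ℕ} (L : (ℂ × (Fin (m - 1) → ℂ)) ≃L[ℂ] (Fin m → ℂ)) :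
    ∃ c : ℝ, ∀ (f : MvPolynomial (Fin m) ℂ) (g : (Fin m → ℂ) → ℝ),
      (∀ᵐ y, (linePoly f (L (1, 0)) (L (0, y))).Separable) →
      ContDiff ℝ ∞ g → HasCompactSupport g →
      Integrable (fun z => Real.log ‖MvPolynomial.eval z f‖ * dirLaplacian (L (1, 0)) g z) →
      ∀ 𝒟 : ChartDecomposition (regularPoints (zeroSet f)),
        (∀ i, IntegrableOn (fun w =>
          (fderiv ℝ (fun w => (L.symm (𝒟.ψ i w)).2) w).det * g (𝒟.ψ i w)) (𝒟.B i)) ∧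
        HasSum (fun i => ∫ w in 𝒟.B i,
          (fderiv ℝ (fun w => (L.symm (𝒟.ψ i w)).2) w).det * g (𝒟.ψ i w))
          (c * ∫ z, Real.log ‖MvPolynomial.eval z f‖ * dirLaplacian (L (1, 0)) g z) := by
  obtain ⟨c, hcL⟩ := exists_integral_comp_equiv L
  refine ⟨1 / (2 * Real.pi) * c, fun f g hsep hg hc hint 𝒟 => ?_⟩
  have hfin : ∀ᵐ y, (regularPoints (zeroSet f) ∩ (fun z => (L.symm z).2) ⁻¹' {y}).Finite ∧
      (regularPoints (zeroSet f) ∩ (fun z => (L.symm z).2) ⁻¹' {y}).ncard ≤ f.totalDegree := by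
    filter_upwards [hsep] with y hy
    rw [regularPoints_inter_fiber f L hy]
    refine ⟨(Finset.finite_toSet _).image _, (ncard_image_le (Finset.finite_toSet _)).trans ?_⟩
    rw [ncard_coe_finset]
    exact (Multiset.toFinset_card_le _).trans
      ((card_roots' _).trans (natDegree_linePoly_le _ _ _))
  obtain ⟨h1, h2⟩ := hasSum_integral_chartDecomposition 𝒟
    ((ContinuousLinearMap.snd ℂ ℂ (Fin (m - 1) → ℂ)).comp
      (L.symm : (Fin m → ℂ) →L[ℂ] ℂ × (Fin (m - 1) → ℂ))) hg.continuous hc _ hfin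
  refine ⟨h1, ?_⟩
  convert! h2 using 1
  obtain ⟨h3, h4⟩ := hcL _ hint
  rw [mul_assoc, ← h4]
  rw [Measure.volume_eq_prod] at h3 ⊢
  rw [integral_prod_symm _ h3, ← integral_const_mul]
  refine integral_congr_ae ?_
  filter_upwards [hsep] with y hy
  exact (tsum_fiber_eq f L hy hg hc).symm

/-! ### Forms of bidegree `(m-1, m-1)` as sums of pull-backs of volume forms -/

section Alternating

variable {V : Type*} [AddCommGroup V] [Module ℝ V]

/-- The contraction of the form `θ` with the vectors `x` and `y`. -/
noncomputable def contract₂ {N : ℕ} (θ : V [⋀^Fin (N + 2)]→ₗ[ℝ] ℝ) (x y : V) :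
    V [⋀^Fin N]→ₗ[ℝ] ℝ :=
  (θ.curryLeft x).curryLeft y

theorem contract₂_apply {N : ℕ} (θ : V [⋀^Fin (N + 2)]→ₗ[ℝ] ℝ) (x y : V) (v : Fin N → V) :
    contract₂ θ x y v = θ (Matrix.vecCons x (Matrix.vecCons y v)) := rfl

theorem contract₂_self {N : ℕ} (θ : V [⋀^Fin (N + 2)]→ₗ[ℝ] ℝ) (x : V) : contract₂ θ x x = 0 :=
  θ.curryLeft_same x

theorem contract₂_add_left {N : ℕ} (θ : V [⋀^Fin (N + 2)]→ₗ[ℝ] ℝ) (x x' y : V) :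
    contract₂ θ (x + x') y = contract₂ θ x y + contract₂ θ x' y := by
  simp [contract₂]

theorem contract₂_add_right {N : ℕ} (θ : V [⋀^Fin (N + 2)]→ₗ[ℝ] ℝ) (x y y' : V) :
    contract₂ θ x (y + y') = contract₂ θ x y + contract₂ θ x y' := by
  simp [contract₂]

theorem contract₂_neg_left {N : ℕ} (θ : V [⋀^Fin (N + 2)]→ₗ[ℝ] ℝ) (x y : V) :
    contract₂ θ (-x) y = -contract₂ θ x y := by
  have h := contract₂_add_left θ (-x) x y
  rw [neg_add_cancel, show contract₂ θ 0 y = 0 by simp [contract₂]] at h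
  exact eq_neg_of_add_eq_zero_left h.symm

theorem contract₂_swap {N : ℕ} (θ : V [⋀^Fin (N + 2)]→ₗ[ℝ] ℝ) (x y : V) :
    contract₂ θ x y = -contract₂ θ y x := by
  have h := contract₂_self θ (x + y)
  rw [contract₂_add_left, contract₂_add_right, contract₂_add_right, contract₂_self, contract₂_self,
    zero_add, add_zero] at h
  exact eq_neg_of_add_eq_zero_left h

theorem contract₂_eq_zero_left {N : ℕ} (θ : V [⋀^Fin (N + 2)]→ₗ[ℝ] ℝ) {x y : V} {v : Fin N → V}
    {j : Fin N} (h : v j = x) : contract₂ θ x y v = 0 := by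
  rw [contract₂_apply]
  exact θ.map_eq_zero_of_eq _ (i := 0) (j := j.succ.succ) (by simp [h]) (by simp [Fin.ext_iff])

theorem contract₂_eq_zero_right {N : ℕ} (θ : V [⋀^Fin (N + 2)]→ₗ[ℝ] ℝ) {x y : V} {v : Fin N → V}
    {j : Fin N} (h : v j = y) : contract₂ θ x y v = 0 := by
  rw [contract₂_swap, AlternatingMap.neg_apply, contract₂_eq_zero_left θ h, neg_zero]

theorem contract₂_neg_right {N : ℕ} (θ : V [⋀^Fin (N + 2)]→ₗ[ℝ] ℝ) (x y : V) :
    contract₂ θ x (-y) = -contract₂ θ x y := by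
  rw [contract₂_swap, contract₂_neg_left, ← contract₂_swap]

theorem alternatingMap_sum_apply {N : ℕ} {ι : Type*} (s : Finset ι) (θ : ι → V [⋀^Fin N]→ₗ[ℝ] ℝ)
    (v : Fin N → V) : (∑ i ∈ s, θ i) v = ∑ i ∈ s, θ i v := by
  classical
  induction s using Finset.induction_on with
  | empty => simp
  | insert i s hi ih => rw [Finset.sum_insert hi, Finset.sum_insert hi,
      AlternatingMap.add_apply, ih]

/-- An enumeration of the indices different from `p.1` and `p.2`. -/
noncomputable def complEnum {N : ℕ} (p : {p : Fin (N + 2) × Fin (N + 2) // p.1 < p.2}) :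
    Fin N ↪o Fin (N + 2) :=
  (({p.1.1, p.1.2} : Finset (Fin (N + 2)))ᶜ).orderEmbOfFin (by
    rw [Finset.card_compl, Finset.card_pair p.2.ne, Fintype.card_fin, Nat.add_sub_cancel])

theorem range_complEnum {N : ℕ} (p : {p : Fin (N + 2) × Fin (N + 2) // p.1 < p.2}) :
    range (complEnum p) = {p.1.1, p.1.2}ᶜ := by
  rw [complEnum, Finset.range_orderEmbOfFin, Finset.coe_compl, Finset.coe_pair]

theorem exists_perm_of_range_eq {ι κ : Type*} {s t : ι → κ} (hs : Function.Injective s)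
    (ht : Function.Injective t) (h : range t = range s) : ∃ σ : Equiv.Perm ι, t = s ∘ σ := by
  refine ⟨(Equiv.ofInjective t ht).trans ((Equiv.setCongr h).trans (Equiv.ofInjective s hs).symm),
    ?_⟩
  ext i
  simp only [Function.comp_apply, Equiv.trans_apply]
  rw [Equiv.apply_ofInjective_symm hs]
  rfl

theorem contract₂_det_complEnum_ne_zero {N : ℕ} (b : Module.Basis (Fin (N + 2)) ℝ V)
    (p : {p : Fin (N + 2) × Fin (N + 2) // p.1 < p.2}) :
    contract₂ b.det (b p.1.1) (b p.1.2) (b ∘ complEnum p) ≠ 0 := by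
  have h1 : (Matrix.vecCons (b p.1.1) (Matrix.vecCons (b p.1.2) (b ∘ complEnum p)))
      = b ∘ (Matrix.vecCons p.1.1 (Matrix.vecCons p.1.2 (complEnum p))) := by
    ext i
    refine Fin.cases ?_ (fun i => Fin.cases ?_ (fun i => ?_) i) i <;> simp
  have hr := range_complEnum p
  have h2 : Function.Injective (Matrix.vecCons p.1.1 (Matrix.vecCons p.1.2 (complEnum p))) := by
    have hx : ∀ i, complEnum p i ≠ p.1.1 ∧ complEnum p i ≠ p.1.2 := fun i => by
      have : complEnum p i ∈ range (complEnum p) := mem_range_self i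
      rw [hr] at this
      simpa using this
    refine Fin.cons_injective_iff.mpr ⟨?_, Fin.cons_injective_iff.mpr ⟨?_, (complEnum p).injective⟩⟩
    · rintro ⟨i, hi⟩
      revert hi
      refine Fin.cases (fun hi => ?_) (fun i hi => ?_) i
      · exact p.2.ne hi.symm
      · exact (hx i).1 hi
    · rintro ⟨i, hi⟩
      exact (hx i).2 hi
  obtain ⟨σ, hσ⟩ : ∃ σ : Equiv.Perm (Fin (N + 2)),
      Matrix.vecCons p.1.1 (Matrix.vecCons p.1.2 (complEnum p)) = σ :=
    ⟨Equiv.ofBijective _ (Finite.injective_iff_bijective.mp h2), rfl⟩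
  rw [contract₂_apply, h1, hσ, AlternatingMap.map_perm, b.det_self]
  rcases Int.units_eq_one_or (Equiv.Perm.sign σ) with h | h <;> simp [h]

/-- Every form of degree `N` on a space of dimension `N + 2` is a combination of contractions of
the volume form; the coefficients are values of the form. -/
theorem eq_sum_contract₂ {N : ℕ} (b : Module.Basis (Fin (N + 2)) ℝ V)
    (θ : V [⋀^Fin N]→ₗ[ℝ] ℝ) :
    θ = ∑ p : {p : Fin (N + 2) × Fin (N + 2) // p.1 < p.2},
      (θ (b ∘ complEnum p) / contract₂ b.det (b p.1.1) (b p.1.2) (b ∘ complEnum p)) •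
        contract₂ b.det (b p.1.1) (b p.1.2) := by
  classical
  -- evaluated on the basis vectors with indices in the range of `t`, only the term of the pair
  -- `{x, y}` of remaining indices survives
  refine Module.Basis.ext_alternating b fun t ht => ?_
  have hcard : ((Finset.univ.image t)ᶜ).card = 2 := by
    rw [Finset.card_compl, Finset.card_image_of_injective _ ht, Finset.card_univ,
      Fintype.card_fin, Fintype.card_fin]
    omega
  obtain ⟨x, y, hxy, hcompl⟩ : ∃ x y, x < y ∧ (Finset.univ.image t)ᶜ = {x, y} := by
    obtain ⟨x, y, hne, h⟩ := Finset.card_eq_two.mp hcard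
    rcases lt_or_gt_of_ne hne with hlt | hlt
    · exact ⟨x, y, hlt, h⟩
    · exact ⟨y, x, hlt, by rw [h, Finset.pair_comm]⟩
  have hmem : ∀ i, i ∈ range t ↔ i ≠ x ∧ i ≠ y := by
    intro i
    have : i ∈ (Finset.univ.image t)ᶜ ↔ i ∈ ({x, y} : Finset (Fin (N + 2))) := by rw [hcompl]
    simp only [Finset.mem_compl, Finset.mem_image, Finset.mem_univ, true_and, Finset.mem_insert,
      Finset.mem_singleton] at this
    rw [mem_range]
    tauto
  set p₀ : {p : Fin (N + 2) × Fin (N + 2) // p.1 < p.2} := ⟨(x, y), hxy⟩ with hp₀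
  have hrange : range t = range (complEnum p₀) := by
    rw [range_complEnum]
    ext i
    rw [hmem]
    simp [hp₀]
  obtain ⟨σ, hσ⟩ := exists_perm_of_range_eq (complEnum p₀).injective ht hrange
  rw [alternatingMap_sum_apply, Finset.sum_eq_single p₀]
  · have hbt : (fun i => b (t i)) = (b ∘ complEnum p₀) ∘ σ := by
      rw [hσ]; rfl
    rw [AlternatingMap.smul_apply, hbt, AlternatingMap.map_perm, AlternatingMap.map_perm]
    have := contract₂_det_complEnum_ne_zero b p₀
    simp only [smul_eq_mul, Units.smul_def, zsmul_eq_mul]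
    field_simp
  · intro p _ hp
    rw [AlternatingMap.smul_apply]
    have hor : p.1.1 ∈ range t ∨ p.1.2 ∈ range t := by
      by_contra! h
      rw [hmem, hmem] at h
      have hlt := p.2
      have hpx : p.1.1 = x ∧ p.1.2 = y := by
        constructor <;> grind
      exact hp (Subtype.ext (Prod.ext hpx.1 hpx.2))
    rcases hor with ⟨j, hj⟩ | ⟨j, hj⟩
    · rw [contract₂_eq_zero_left b.det (v := fun i => b (t i)) (j := j) (by simp only [hj]),
        smul_zero]
    · rw [contract₂_eq_zero_right b.det (v := fun i => b (t i)) (j := j) (by simp only [hj]),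
        smul_zero]
  · simp

/-- Polarization: with `H u = contract₂ θ u (J u)`, a `J`-symmetrized contraction is
`H (x - J y) - H x - H y`. -/
theorem contract₂_add_contract₂_eq {N : ℕ} (θ : V [⋀^Fin (N + 2)]→ₗ[ℝ] ℝ) (J : V →ₗ[ℝ] V)
    (hJ : ∀ x, J (J x) = -x) (x y : V) :
    contract₂ θ x y + contract₂ θ (J x) (J y) =
      contract₂ θ (x + -J y) (J (x + -J y)) - contract₂ θ x (J x) - contract₂ θ y (J y) := by
  rw [map_add, map_neg, hJ, neg_neg, contract₂_add_left, contract₂_add_right, contract₂_add_right,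
    contract₂_neg_left, contract₂_neg_left, ← contract₂_swap θ (J x) (J y),
    ← contract₂_swap θ y (J y)]
  abel

/-- A form of degree `N` that is invariant under a complex structure `J` of determinant one is a
combination of the forms `contract₂ vol u (J u)`. -/
theorem eq_sum_contract₂_of_invariant {N : ℕ} (b : Module.Basis (Fin (N + 2)) ℝ V)
    (J : V →ₗ[ℝ] V) (hJ : ∀ x, J (J x) = -x) (hdet : LinearMap.det J = 1)
    (θ : V [⋀^Fin N]→ₗ[ℝ] ℝ) (hθ : ∀ v : Fin N → V, θ (fun i => J (v i)) = θ v) :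
    θ = ∑ p : {p : Fin (N + 2) × Fin (N + 2) // p.1 < p.2},
      (θ (b ∘ complEnum p) / contract₂ b.det (b p.1.1) (b p.1.2) (b ∘ complEnum p) / 2) •
        (contract₂ b.det (b p.1.1 + -J (b p.1.2)) (J (b p.1.1 + -J (b p.1.2)))
          - contract₂ b.det (b p.1.1) (J (b p.1.1)) - contract₂ b.det (b p.1.2) (J (b p.1.2))) := by
  have hvol : ∀ x y (v : Fin N → V), contract₂ b.det x y (fun i => J (v i))
      = contract₂ b.det (J x) (J y) v := by
    intro x y v
    have h1 := b.det_comp J (Matrix.vecCons (-J x) (Matrix.vecCons (-J y) v))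
    rw [hdet, one_mul] at h1
    have h2 : J ∘ Matrix.vecCons (-J x) (Matrix.vecCons (-J y) v)
        = Matrix.vecCons x (Matrix.vecCons y fun i => J (v i)) := by
      ext i
      refine Fin.cases ?_ (fun i => Fin.cases ?_ (fun i => ?_) i) i <;> simp [hJ]
    rw [h2, ← contract₂_apply, ← contract₂_apply, contract₂_neg_left, contract₂_neg_right,
      neg_neg] at h1
    exact h1
  ext v
  have h1 := congrArg (fun η : V [⋀^Fin N]→ₗ[ℝ] ℝ => η v) (eq_sum_contract₂ b θ)
  have h2 := congrArg (fun η : V [⋀^Fin N]→ₗ[ℝ] ℝ => η fun i => J (v i)) (eq_sum_contract₂ b θ)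
  simp only [hθ] at h2
  rw [alternatingMap_sum_apply] at h1 h2 ⊢
  simp only [AlternatingMap.smul_apply, hvol] at h1 h2
  have h3 : θ v = (θ v + θ v) / 2 := by ring
  rw [h3]
  nth_rewrite 1 [h1]
  rw [h2, ← Finset.sum_add_distrib, Finset.sum_div]
  refine Finset.sum_congr rfl fun p _ => ?_
  rw [← contract₂_add_contract₂_eq b.det J hJ, AlternatingMap.smul_apply, AlternatingMap.add_apply]
  simp only [smul_eq_mul]
  ring

/-- A form that vanishes as soon as one argument lies in a subspace descends to the quotient. -/
theorem alternating_eq_of_sub_mem {N : ℕ} (θ : V [⋀^Fin N]→ₗ[ℝ] ℝ) (S : Submodule ℝ V)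
    (hS : ∀ (v : Fin N → V) (j : Fin N), v j ∈ S → θ v = 0) (v s : Fin N → V)
    (hs : ∀ j, s j ∈ S) : θ (v + s) = θ v := by
  classical
  have h := θ.toMultilinearMap.map_add_univ v s
  rw [Finset.sum_eq_single Finset.univ] at h
  · simpa using h
  · intro A _ hA
    obtain ⟨j, hj⟩ : ∃ j, j ∉ A := by
      by_contra! hc
      exact hA (Finset.eq_univ_iff_forall.mpr hc)
    exact hS _ j (by simpa [Finset.piecewise_eq_of_notMem _ _ _ hj] using hs j)
  · simp

end Alternating

/-- The real basis `e₁, i e₁, e₂, i e₂, …` of `ℂ^k`. -/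
noncomputable def complexFrameBasis (k : ℕ) : Module.Basis (Fin (k * 2)) ℝ (Fin k → ℂ) :=
  (Pi.basis fun _ : Fin k => Complex.basisOneI).reindex
    ((Equiv.sigmaEquivProd (Fin k) (Fin 2)).trans finProdFinEquiv)

theorem coe_complexFrameBasis (k : ℕ) : ⇑(complexFrameBasis k) = complexFrame k := by
  ext1 j
  rw [complexFrameBasis, Module.Basis.reindex_apply]
  obtain ⟨⟨i, a⟩, rfl⟩ := finProdFinEquiv.surjective j
  have h : ((Equiv.sigmaEquivProd (Fin k) (Fin 2)).trans finProdFinEquiv).symm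
      (finProdFinEquiv (i, a)) = ⟨i, a⟩ := by
    simp
  rw [h, Pi.basis_apply, complexFrame, Equiv.symm_apply_apply]
  congr 1
  fin_cases a <;> simp

/-- The volume form of `ℂ^k`, evaluated on the image of the standard frame, is the determinant. -/
theorem det_complexFrameBasis_map {k : ℕ} (A : (Fin k → ℂ) →L[ℝ] (Fin k → ℂ)) :
    (complexFrameBasis k).det (fun j => A (complexFrame k j)) = A.det := by
  have h := (complexFrameBasis k).det_comp (A : (Fin k → ℂ) →ₗ[ℝ] (Fin k → ℂ))
    (complexFrameBasis k)
  rw [Module.Basis.det_self, mul_one, coe_complexFrameBasis] at h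
  exact h

/-- Multiplication by `i` on a complex vector space, as a real linear map. -/
noncomputable def mulI (E : Type*) [AddCommGroup E] [Module ℂ E] [Module ℝ E]
    [IsScalarTower ℝ ℂ E] : E →ₗ[ℝ] E :=
  (LinearMap.lsmul ℂ E Complex.I).restrictScalars ℝ

theorem mulI_apply {E : Type*} [AddCommGroup E] [Module ℂ E] [Module ℝ E]
    [IsScalarTower ℝ ℂ E] (x : E) : mulI E x = Complex.I • x := rfl

theorem det_mulI (m : ℕ) : LinearMap.det (mulI (Fin m → ℂ)) = 1 := by
  have h : LinearMap.lsmul ℂ (Fin m → ℂ) Complex.I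
      = Complex.I • (LinearMap.id : (Fin m → ℂ) →ₗ[ℂ] (Fin m → ℂ)) := rfl
  rw [mulI, LinearMap.det_restrictScalars, h, LinearMap.det_smul, LinearMap.det_id, mul_one,
    Algebra.norm_complex_apply, map_pow, Complex.normSq_I, one_pow]

/-- Coordinates `ℂ × ℂ^(m-1)` of `ℂ^m` whose first axis has a prescribed direction. -/
theorem exists_equiv_apply_eq {m : ℕ} (hm : 1 ≤ m) {u : Fin m → ℂ} (hu : u ≠ 0) :
    ∃ L : (ℂ × (Fin (m - 1) → ℂ)) ≃L[ℂ] (Fin m → ℂ), L (1, 0) = u := by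
  have hrank : Module.finrank ℂ (ℂ × (Fin (m - 1) → ℂ)) = Module.finrank ℂ (Fin m → ℂ) := by
    rw [Module.finrank_prod]
    simp
    omega
  let L₀ := ContinuousLinearEquiv.ofFinrankEq hrank
  have h0 : L₀ (1, 0) ≠ 0 := by simp
  obtain ⟨A, hA⟩ := SeparatingDual.exists_continuousLinearEquiv_apply_eq (R := ℂ) h0 hu
  exact ⟨L₀.trans A, hA⟩

/-- The contraction of the volume form of `ℂ^m` with `u` and `iu` is a multiple of the pull-back
of the volume form of `ℂ^(m-1)` under a projection along `u`. -/
theorem exists_contract₂_eq {m : ℕ} (hm : 1 ≤ m)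
    (θ : (Fin m → ℂ) [⋀^Fin ((m - 1) * 2 + 2)]→ₗ[ℝ] ℝ) (u : Fin m → ℂ) :
    ∃ (L : (ℂ × (Fin (m - 1) → ℂ)) ≃L[ℂ] (Fin m → ℂ)) (κ : ℝ),
      ∀ v, contract₂ θ u (mulI _ u) v
        = κ * (complexFrameBasis (m - 1)).det fun j => (L.symm (v j)).2 := by
  rcases eq_or_ne u 0 with rfl | hu
  · have : NeZero m := ⟨by omega⟩
    obtain ⟨L, -⟩ := exists_equiv_apply_eq hm (u := fun _ => 1)
      (fun h => one_ne_zero (congrFun h 0))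
    refine ⟨L, 0, fun v => ?_⟩
    simp [contract₂]
  obtain ⟨L, hL⟩ := exists_equiv_apply_eq hm hu
  let ι : (Fin (m - 1) → ℂ) →ₗ[ℝ] (Fin m → ℂ) :=
    ((L : (ℂ × (Fin (m - 1) → ℂ)) →ₗ[ℂ] (Fin m → ℂ)).comp
      (LinearMap.inr ℂ ℂ (Fin (m - 1) → ℂ))).restrictScalars ℝ
  have hι : ∀ y, ι y = L (0, y) := fun y => rfl
  set η := (contract₂ θ u (mulI _ u)).compLinearMap ι with hη
  refine ⟨L, η (complexFrameBasis (m - 1)), fun v => ?_⟩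
  have h1 := congrArg (fun ξ => ξ fun j => (L.symm (v j)).2)
    (AlternatingMap.eq_smul_basis_det (complexFrameBasis (m - 1)) η)
  simp only [AlternatingMap.smul_apply, smul_eq_mul] at h1
  rw [← h1, hη, AlternatingMap.compLinearMap_apply]
  have h2 : v = (fun j => ι (L.symm (v j)).2) + fun j => (L.symm (v j)).1 • u := by
    ext1 j
    simp only [Pi.add_apply, hι]
    rw [← hL, ← map_smul, ← map_add]
    conv_lhs => rw [← L.apply_symm_apply (v j)]
    congr 1
    ext1 <;> simp
  conv_lhs => rw [h2]
  refine alternating_eq_of_sub_mem _ (Submodule.span ℝ {u, mulI _ u}) (fun w j hw => ?_) _ _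
    fun j => ?_
  · obtain ⟨a, b, hab⟩ := Submodule.mem_span_pair.mp hw
    have h3 : w = Function.update w j (a • u + b • mulI _ u) := by simp [hab]
    rw [h3, AlternatingMap.map_update_add, AlternatingMap.map_update_smul,
      AlternatingMap.map_update_smul, contract₂_eq_zero_left θ (j := j) (by simp),
      contract₂_eq_zero_right θ (j := j) (by simp)]
    simp
  · refine Submodule.mem_span_pair.mpr ⟨(L.symm (v j)).1.re, (L.symm (v j)).1.im, ?_⟩
    rw [mulI_apply]
    ext i
    simp only [Pi.add_apply, Pi.smul_apply, Complex.real_smul, smul_eq_mul]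
    conv_rhs => rw [← Complex.re_add_im (L.symm (v j)).1]
    ring

/-- A test form of bidegree `(m-1, m-1)` is a finite sum of pull-backs of the volume form of
`ℂ^(m-1)` under linear projections, multiplied by test functions. -/
theorem TestForm.exists_eq_sum {m : ℕ} (hm : 1 ≤ m) (φ : TestForm m) :
    ∃ (ι : Type) (_ : Fintype ι) (_ : Nonempty ι)
      (L : ι → (ℂ × (Fin (m - 1) → ℂ)) ≃L[ℂ] (Fin m → ℂ)) (g : ι → (Fin m → ℂ) → ℝ),
      (∀ k, ContDiff ℝ ∞ (g k)) ∧ (∀ k, HasCompactSupport (g k)) ∧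
      ∀ z v, φ.toFun z v
        = ∑ k, g k z * (complexFrameBasis (m - 1)).det fun j => ((L k).symm (v j)).2 := by
  have hrank : Module.finrank ℝ (Fin m → ℂ) = (m - 1) * 2 + 2 := by
    rw [Module.finrank_pi_fintype]
    simp
    omega
  let b : Module.Basis (Fin ((m - 1) * 2 + 2)) ℝ (Fin m → ℂ) := Module.finBasisOfFinrankEq _ _ hrank
  let J := mulI (Fin m → ℂ)
  have hJ : ∀ x, J (J x) = -x := fun x => by
    simp only [J, mulI_apply, smul_smul, Complex.I_mul_I, neg_smul, one_smul]
  let P := {p : Fin ((m - 1) * 2 + 2) × Fin ((m - 1) * 2 + 2) // p.1 < p.2}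
  choose L κ hLκ using exists_contract₂_eq hm b.det
  -- the directions and the coefficients that belong to an index pair
  let u : P × Fin 3 → Fin m → ℂ := fun k =>
    ![b k.1.1.1 + -J (b k.1.1.2), b k.1.1.1, b k.1.1.2] k.2
  let s : Fin 3 → ℝ := ![1, -1, -1]
  let a : P → ℝ := fun p => contract₂ b.det (b p.1.1) (b p.1.2) (b ∘ complEnum p)
  let g : P × Fin 3 → (Fin m → ℂ) → ℝ := fun k z =>
    φ.toFun z (b ∘ complEnum k.1) * ((a k.1)⁻¹ / 2 * s k.2 * κ (u k))
  have hP : Nonempty P := ⟨⟨(0, 1), by simp⟩⟩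
  refine ⟨P × Fin 3, inferInstance, inferInstance, fun k => L (u k), g, fun k => ?_, fun k => ?_,
    fun z v => ?_⟩
  · refine ContDiff.mul ?_ contDiff_const
    exact (ContinuousAlternatingMap.apply ℝ (Fin m → ℂ) ℝ
      (b ∘ complEnum k.1)).contDiff.comp φ.smooth
  · refine HasCompactSupport.mul_right ?_
    exact φ.compactSupport.comp_left (g := fun θ : (Fin m → ℂ) [⋀^Fin ((m - 1) * 2)]→L[ℝ] ℝ =>
      θ (b ∘ complEnum k.1)) rfl
  · have h := eq_sum_contract₂_of_invariant b J hJ (det_mulI m)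
      (φ.toFun z).toAlternatingMap (fun v => φ.bidegree z Complex.I (by simp) v)
    have h1 := congrArg (fun η => η v) h
    rw [alternatingMap_sum_apply] at h1
    refine Eq.trans (show φ.toFun z v = _ from h1) ?_
    rw [Fintype.sum_prod_type]
    refine Finset.sum_congr rfl fun p _ => ?_
    rw [Fin.sum_univ_three]
    simp only [AlternatingMap.smul_apply, AlternatingMap.sub_apply, smul_eq_mul, g, u, s,
      Matrix.cons_val_zero, Matrix.cons_val_one, Matrix.cons_val]
    simp only [J, hLκ, a, ContinuousAlternatingMap.coe_toAlternatingMap]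
    ring

/-- The density of the pull-back of a test form under a holomorphic map, in terms of the
decomposition of the form. -/
theorem pullbackDensity_eq_sum {m : ℕ} {φ : TestForm m} {ι : Type} [Fintype ι]
    {L : ι → (ℂ × (Fin (m - 1) → ℂ)) ≃L[ℂ] (Fin m → ℂ)} {g : ι → (Fin m → ℂ) → ℝ}
    (h : ∀ z v, φ.toFun z v
        = ∑ k, g k z * (complexFrameBasis (m - 1)).det fun j => ((L k).symm (v j)).2)
    {ψ : (Fin (m - 1) → ℂ) → Fin m → ℂ} {w : Fin (m - 1) → ℂ} (hψ : DifferentiableAt ℂ ψ w) :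
    pullbackDensity φ ψ w
      = ∑ k, (fderiv ℝ (fun w => ((L k).symm (ψ w)).2) w).det * g k (ψ w) := by
  rw [pullbackDensity, h]
  refine Finset.sum_congr rfl fun k _ => ?_
  let π : (Fin m → ℂ) →L[ℂ] (Fin (m - 1) → ℂ) :=
    (ContinuousLinearMap.snd ℂ ℂ (Fin (m - 1) → ℂ)).comp ((L k).symm : (Fin m → ℂ) →L[ℂ] _)
  have h1 : HasFDerivAt (fun w => ((L k).symm (ψ w)).2) (π.comp (fderiv ℂ ψ w)) w :=
    π.hasFDerivAt.comp w hψ.hasFDerivAt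
  rw [(h1.restrictScalars ℝ).fderiv, ← det_complexFrameBasis_map, mul_comm]
  rfl

/-! ### The Poincaré–Lelong formula -/

/-- The Poincaré–Lelong formula `⟨[Z_f], φ⟩ = ∫ log |f| G` for polynomials that are separable along
almost all lines of finitely many directions.  The function `G`, essentially `∂∂̄φ`, and the
directions depend on `φ` only. -/
theorem exists_zeroCurrent_eq {m : ℕ} (hm : 1 ≤ m) (φ : TestForm m) :
    ∃ (ι : Type) (_ : Fintype ι) (_ : Nonempty ι)
      (L : ι → (ℂ × (Fin (m - 1) → ℂ)) ≃L[ℂ] (Fin m → ℂ)) (h : ι → (Fin m → ℂ) → ℝ)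
      (G : (Fin m → ℂ) → ℝ), (∀ k, Continuous (h k)) ∧ (∀ k, HasCompactSupport (h k)) ∧
      Continuous G ∧ HasCompactSupport G ∧
      ∀ f : MvPolynomial (Fin m) ℂ,
        (∀ k, ∀ᵐ y, (linePoly f (L k (1, 0)) (L k (0, y))).Separable) →
        (∀ k, Integrable fun z => Real.log ‖MvPolynomial.eval z f‖ * h k z) →
        zeroCurrent f φ = ∫ z, Real.log ‖MvPolynomial.eval z f‖ * G z := by
  obtain ⟨ι, hι, hne, L, g, hg, hc, hφ⟩ := φ.exists_eq_sum hm
  choose c hPL using fun k => exists_poincareLelong (L k)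
  have hΔ : ∀ k, Continuous (dirLaplacian (L k (1, 0)) (g k)) := fun k =>
    continuous_dirLaplacian (hg k) _
  have hΔc : ∀ k, HasCompactSupport (dirLaplacian (L k (1, 0)) (g k)) := fun k =>
    hasCompactSupport_dirLaplacian (hc k) _
  refine ⟨ι, hι, hne, L, fun k => dirLaplacian (L k (1, 0)) (g k),
    fun z => ∑ k, c k * dirLaplacian (L k (1, 0)) (g k) z, hΔ, hΔc,
    continuous_finsetSum _ fun k _ => continuous_const.mul (hΔ k), ?_, fun f hsep hint => ?_⟩
  · have : ∀ s : Finset ι,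
        HasCompactSupport fun z => ∑ k ∈ s, c k * dirLaplacian (L k (1, 0)) (g k) z := by
      classical
      intro s
      induction s using Finset.induction_on with
      | empty =>
        simp only [Finset.sum_empty]
        exact HasCompactSupport.zero
      | insert k s hk ih =>
        simp only [Finset.sum_insert hk]
        exact ((hΔc k).mul_left (f := fun _ => c k)).add ih
    exact this _
  rw [zeroCurrent, integralOver, dif_pos (nonempty_chartDecomposition _)]
  set 𝒟 := (nonempty_chartDecomposition (zeroSet f)).some
  have hk := fun k => hPL k f (g k) (hsep k) (hg k) (hc k) (hint k) 𝒟
  have hsum : HasSum (fun i => ∑ k, ∫ w in 𝒟.B i,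
      (fderiv ℝ (fun w => ((L k).symm (𝒟.ψ i w)).2) w).det * g k (𝒟.ψ i w))
      (∑ k, c k * ∫ z, Real.log ‖MvPolynomial.eval z f‖ * dirLaplacian (L k (1, 0)) (g k) z) :=
    hasSum_sum fun k _ => (hk k).2
  have hpiece : ∀ i, ∫ w in 𝒟.B i, pullbackDensity φ (𝒟.ψ i) w = ∑ k, ∫ w in 𝒟.B i,
      (fderiv ℝ (fun w => ((L k).symm (𝒟.ψ i w)).2) w).det * g k (𝒟.ψ i w) := by
    intro i
    rw [← integral_finsetSum _ fun k _ => (hk k).1 i]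
    refine setIntegral_congr_fun (𝒟.measurable i) fun w hw => ?_
    refine pullbackDensity_eq_sum hφ ?_
    exact (𝒟.isLocalParam i).2.1.differentiableAt
      ((𝒟.isLocalParam i).1.mem_nhds (𝒟.subset i hw))
  simp only [hpiece]
  rw [hsum.tsum_eq]
  simp only [Finset.mul_sum]
  rw [integral_finsetSum]
  · refine Finset.sum_congr rfl fun k _ => ?_
    rw [← integral_const_mul]
    refine integral_congr_ae (Eventually.of_forall fun z => ?_)
    simp only
    ring
  · intro k _
    refine ((hint k).const_mul (c k)).congr (Eventually.of_forall fun z => ?_)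
    simp only
    ring

/-! ### Second moments of smeared random functions -/

/-- If the second moments of the random variables `ℓ(·, x)` are at most `M`, then the second moment
of `∫ ℓ(·, x) h(x) dx` is at most `‖h‖₁² M`, by the Cauchy–Schwarz inequality and Tonelli's
theorem. -/
theorem lintegral_sq_integral_mul_le {Ω X : Type*} [MeasurableSpace Ω] [MeasurableSpace X]
    {μ : Measure Ω} {lam : Measure X} [SFinite μ] [SFinite lam] {ℓ : Ω → X → ℝ}
    (hℓ : Measurable (Function.uncurry ℓ)) {h : X → ℝ} (hh : Measurable h) (hi : Integrable h lam)
    {M : ENNReal} (hM : M ≠ ⊤) (hbound : ∀ x, ∫⁻ a, ‖ℓ a x‖ₑ ^ (2 : ℝ) ∂μ ≤ M) :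
    (∀ᵐ a ∂μ, Integrable (fun x => ℓ a x * h x) lam) ∧
    AEStronglyMeasurable (fun a => ∫ x, ℓ a x * h x ∂lam) μ ∧
    ∫⁻ a, ‖∫ x, ℓ a x * h x ∂lam‖ₑ ^ (2 : ℝ) ∂μ ≤ (∫⁻ x, ‖h x‖ₑ ∂lam) ^ (2 : ℝ) * M := by
  have hmeas : Measurable (Function.uncurry fun a x => ℓ a x * h x) :=
    hℓ.mul (hh.comp measurable_snd)
  set A := ∫⁻ x, ‖h x‖ₑ ∂lam with hA
  have hAtop : A ≠ ⊤ := hi.2.ne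
  have hsec : ∀ a, Measurable (ℓ a) := fun a => hℓ.comp measurable_prodMk_left
  -- the Cauchy–Schwarz inequality with the weight `|h|`
  have hCS : ∀ a, (∫⁻ x, ‖ℓ a x * h x‖ₑ ∂lam) ^ (2 : ℝ)
      ≤ A * ∫⁻ x, ‖ℓ a x‖ₑ ^ (2 : ℝ) * ‖h x‖ₑ ∂lam := by
    intro a
    have h1 := ENNReal.lintegral_mul_le_Lp_mul_Lq lam Real.HolderConjugate.two_two
      (f := fun x => ‖ℓ a x‖ₑ * ‖h x‖ₑ ^ (1 / 2 : ℝ)) (g := fun x => ‖h x‖ₑ ^ (1 / 2 : ℝ))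
      ((hsec a).enorm.mul (hh.enorm.pow_const _)).aemeasurable
      (hh.enorm.pow_const _).aemeasurable
    have h2 : ∀ x, ((fun x => ‖ℓ a x‖ₑ * ‖h x‖ₑ ^ (1 / 2 : ℝ)) * fun x => ‖h x‖ₑ ^ (1 / 2 : ℝ)) x
        = ‖ℓ a x * h x‖ₑ := by
      intro x
      simp only [Pi.mul_apply]
      rw [mul_assoc, ← ENNReal.rpow_add_of_nonneg _ _ (by norm_num) (by norm_num), enorm_mul]
      norm_num
    have h3 : ∀ x, (‖ℓ a x‖ₑ * ‖h x‖ₑ ^ (1 / 2 : ℝ)) ^ (2 : ℝ)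
        = ‖ℓ a x‖ₑ ^ (2 : ℝ) * ‖h x‖ₑ := by
      intro x
      rw [ENNReal.mul_rpow_of_nonneg _ _ (by norm_num), ← ENNReal.rpow_mul]
      norm_num
    have h4 : ∀ x, (‖h x‖ₑ ^ (1 / 2 : ℝ)) ^ (2 : ℝ) = ‖h x‖ₑ := by
      intro x
      rw [← ENNReal.rpow_mul]
      norm_num
    simp only [h2, h3, h4] at h1
    calc (∫⁻ x, ‖ℓ a x * h x‖ₑ ∂lam) ^ (2 : ℝ)
        ≤ ((∫⁻ x, ‖ℓ a x‖ₑ ^ (2 : ℝ) * ‖h x‖ₑ ∂lam) ^ (1 / 2 : ℝ) * A ^ (1 / 2 : ℝ)) ^ (2 : ℝ) :=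
          ENNReal.rpow_le_rpow h1 (by norm_num)
      _ = A * ∫⁻ x, ‖ℓ a x‖ₑ ^ (2 : ℝ) * ‖h x‖ₑ ∂lam := by
          rw [ENNReal.mul_rpow_of_nonneg _ _ (by norm_num), ← ENNReal.rpow_mul, ← ENNReal.rpow_mul]
          norm_num
          rw [mul_comm]
  have hjoint : Measurable (Function.uncurry fun a x => ‖ℓ a x‖ₑ ^ (2 : ℝ) * ‖h x‖ₑ) :=
    (hℓ.enorm.pow_const _).mul (hh.comp measurable_snd).enorm
  have hTon : ∫⁻ a, ∫⁻ x, ‖ℓ a x‖ₑ ^ (2 : ℝ) * ‖h x‖ₑ ∂lam ∂μ ≤ M * A := by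
    rw [lintegral_lintegral_swap hjoint.aemeasurable, hA, ← lintegral_const_mul _ hh.enorm]
    refine lintegral_mono fun x => ?_
    have hx : Measurable fun a => ℓ a x := hℓ.comp measurable_prodMk_right
    rw [lintegral_mul_const _ (hx.enorm.pow_const _)]
    exact mul_le_mul_left (hbound x) _
  have hMA : M * A ≠ ⊤ := ENNReal.mul_ne_top hM hAtop
  refine ⟨?_, ?_, ?_⟩
  · have h1 := ae_lt_top (μ := μ) (f := fun a => ∫⁻ x, ‖ℓ a x‖ₑ ^ (2 : ℝ) * ‖h x‖ₑ ∂lam)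
      hjoint.lintegral_prod_right' (ne_top_of_le_ne_top hMA hTon)
    filter_upwards [h1] with a ha
    refine ⟨((hsec a).mul hh).aestronglyMeasurable, ?_⟩
    rw [HasFiniteIntegral]
    have h2 := (hCS a).trans_lt (ENNReal.mul_lt_top hAtop.lt_top ha)
    by_contra hc
    rw [not_lt_top_iff] at hc
    rw [hc] at h2
    simp at h2
  · exact (hmeas.stronglyMeasurable.integral_prod_right).aestronglyMeasurable
  · calc ∫⁻ a, ‖∫ x, ℓ a x * h x ∂lam‖ₑ ^ (2 : ℝ) ∂μ
        ≤ ∫⁻ a, A * ∫⁻ x, ‖ℓ a x‖ₑ ^ (2 : ℝ) * ‖h x‖ₑ ∂lam ∂μ := by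
          refine lintegral_mono fun a => le_trans ?_ (hCS a)
          exact ENNReal.rpow_le_rpow (enorm_integral_le_lintegral_enorm _) (by norm_num)
      _ = A * ∫⁻ a, ∫⁻ x, ‖ℓ a x‖ₑ ^ (2 : ℝ) * ‖h x‖ₑ ∂lam ∂μ :=
          lintegral_const_mul _ hjoint.lintegral_prod_right'
      _ ≤ A * (M * A) := mul_le_mul_right hTon _
      _ = A ^ (2 : ℝ) * M := by
          rw [ENNReal.rpow_two]
          ring

/-- The logarithmic moment condition of order `α ≥ 2` bounds the second moments. -/
theorem LogMomentBound.lintegral_sq_le {d : ℕ} {μ : Measure (Fin d → ℂ)} [IsProbabilityMeasure μ]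
    {α D : ℝ} (hα : 2 ≤ α) (hD : 0 < D) (h : LogMomentBound μ α D) {v : Fin d → ℂ}
    (hv : ∑ j, ‖v j‖ ^ 2 = 1) :
    ∫⁻ a, ‖Real.log ‖∑ j, a j * v j‖‖ₑ ^ (2 : ℝ) ∂μ ≤ ENNReal.ofReal (D ^ (2 / α)) := by
  have hα0 : 0 < α := by linarith
  have hm : Measurable fun a : Fin d → ℂ => Real.log ‖∑ j, a j * v j‖ := by fun_prop
  have h1 := eLpNorm_le_eLpNorm_of_exponent_le (μ := μ) (p := ENNReal.ofReal 2)
    (q := ENNReal.ofReal α) (ENNReal.ofReal_le_ofReal hα) hm.aestronglyMeasurable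
  rw [eLpNorm_eq_lintegral_rpow_enorm_toReal (by simp) (by simp),
    eLpNorm_eq_lintegral_rpow_enorm_toReal (by simpa using hα0) (by simp),
    ENNReal.toReal_ofReal (by norm_num), ENNReal.toReal_ofReal hα0.le] at h1
  have h2 : ∫⁻ a, ‖Real.log ‖∑ j, a j * v j‖‖ₑ ^ α ∂μ ≤ ENNReal.ofReal D := by
    refine le_trans (lintegral_mono fun a => le_of_eq ?_) (h v hv)
    rw [← ofReal_norm, Real.norm_eq_abs, ENNReal.ofReal_rpow_of_nonneg (abs_nonneg _) hα0.le]
  have h3 := h1.trans (ENNReal.rpow_le_rpow h2 (by positivity : 0 ≤ 1 / α))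
  have h4 := ENNReal.rpow_le_rpow h3 (by norm_num : (0 : ℝ) ≤ 2)
  rw [← ENNReal.rpow_mul, ← ENNReal.rpow_mul, ENNReal.ofReal_rpow_of_pos hD] at h4
  have e1 : (1 / 2 * 2 : ℝ) = 1 := by norm_num
  have e2 : (1 / α * 2 : ℝ) = 2 / α := by ring
  rwa [e1, ENNReal.rpow_one, e2] at h4

/-! ### The variance estimate -/

/-- The Euclidean norm of the vector `(p₁(z), …, p_d(z))`. -/
noncomputable def basisNorm {m n : ℕ} (p : Module.Basis (Fin (polyDim m n)) ℂ (polySpace m n))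
    (z : Fin m → ℂ) : ℝ :=
  √(∑ j, ‖MvPolynomial.eval z (p j : MvPolynomial (Fin m) ℂ)‖ ^ 2)

theorem continuous_basisNorm {m n : ℕ}
    (p : Module.Basis (Fin (polyDim m n)) ℂ (polySpace m n)) : Continuous (basisNorm p) :=
  (continuous_finsetSum _ fun j _ =>
    ((MvPolynomial.continuous_eval (p j : MvPolynomial (Fin m) ℂ)).norm.pow 2)).sqrt

theorem eval_polyOf {m n : ℕ} (p : Module.Basis (Fin (polyDim m n)) ℂ (polySpace m n))
    (a : Fin (polyDim m n) → ℂ) (z : Fin m → ℂ) :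
    MvPolynomial.eval z (polyOf p a)
      = ∑ j, a j * MvPolynomial.eval z (p j : MvPolynomial (Fin m) ℂ) := by
  simp [polyOf, MvPolynomial.smul_eval]

/-- The polynomials of a basis have no common zero, because the constant `1` is a combination of
them. -/
theorem basisNorm_pos {m n : ℕ} (p : Module.Basis (Fin (polyDim m n)) ℂ (polySpace m n))
    (z : Fin m → ℂ) : 0 < basisNorm p z := by
  refine Real.sqrt_pos.mpr ?_
  obtain ⟨j, hj⟩ : ∃ j, MvPolynomial.eval z (p j : MvPolynomial (Fin m) ℂ) ≠ 0 := by
    by_contra! h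
    have hmem : (1 : MvPolynomial (Fin m) ℂ) ∈ polySpace m n := by
      rw [MvPolynomial.mem_restrictTotalDegree]
      simp
    have h1 := congrArg (polySpace m n).subtype (p.sum_repr ⟨1, hmem⟩)
    rw [map_sum] at h1
    have h2 : polyOf p (p.repr ⟨1, hmem⟩) = 1 := h1
    have h3 := eval_polyOf p (p.repr ⟨1, hmem⟩) z
    rw [h2] at h3
    simp [h] at h3
  exact Finset.sum_pos' (fun _ _ => by positivity) ⟨j, Finset.mem_univ _, by positivity⟩

/-- The unit vector `(p₁(z), …, p_d(z)) / |(p₁(z), …, p_d(z))|`. -/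
noncomputable def basisUnit {m n : ℕ} (p : Module.Basis (Fin (polyDim m n)) ℂ (polySpace m n))
    (z : Fin m → ℂ) (j : Fin (polyDim m n)) : ℂ :=
  MvPolynomial.eval z (p j : MvPolynomial (Fin m) ℂ) / (basisNorm p z : ℂ)

theorem sum_norm_sq_basisUnit {m n : ℕ}
    (p : Module.Basis (Fin (polyDim m n)) ℂ (polySpace m n)) (z : Fin m → ℂ) :
    ∑ j, ‖basisUnit p z j‖ ^ 2 = 1 := by
  have hpos := basisNorm_pos p z
  have hsq : basisNorm p z ^ 2 = ∑ j, ‖MvPolynomial.eval z (p j : MvPolynomial (Fin m) ℂ)‖ ^ 2 :=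
    Real.sq_sqrt (Finset.sum_nonneg fun _ _ => by positivity)
  simp only [basisUnit, norm_div, div_pow, Complex.norm_real, Real.norm_eq_abs, sq_abs]
  rw [← Finset.sum_div, ← hsq, div_self (by positivity)]

theorem log_norm_eval_polyOf {m n : ℕ}
    (p : Module.Basis (Fin (polyDim m n)) ℂ (polySpace m n)) {a : Fin (polyDim m n) → ℂ}
    {z : Fin m → ℂ} (h : MvPolynomial.eval z (polyOf p a) ≠ 0) :
    Real.log ‖MvPolynomial.eval z (polyOf p a)‖
      = Real.log ‖∑ j, a j * basisUnit p z j‖ + Real.log (basisNorm p z) := by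
  have hpos := basisNorm_pos p z
  have h1 : MvPolynomial.eval z (polyOf p a)
      = (∑ j, a j * basisUnit p z j) * (basisNorm p z : ℂ) := by
    rw [eval_polyOf, Finset.sum_mul]
    refine Finset.sum_congr rfl fun j _ => ?_
    have : (basisNorm p z : ℂ) ≠ 0 := by exact_mod_cast hpos.ne'
    rw [basisUnit, mul_assoc, div_mul_cancel₀ _ this]
  rw [h1] at h ⊢
  rw [norm_mul, Real.log_mul (by simpa using left_ne_zero_of_mul h)
    (by simpa using right_ne_zero_of_mul h), Complex.norm_real, Real.norm_of_nonneg hpos.le]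

theorem measurable_log_norm_sum_basisUnit {m n : ℕ}
    (p : Module.Basis (Fin (polyDim m n)) ℂ (polySpace m n)) :
    Measurable (Function.uncurry fun (a : Fin (polyDim m n) → ℂ) (z : Fin m → ℂ) =>
      Real.log ‖∑ j, a j * basisUnit p z j‖) := by
  have hu : ∀ j, Continuous fun z => basisUnit p z j := fun j =>
    (MvPolynomial.continuous_eval _).div (Complex.continuous_ofReal.comp (continuous_basisNorm p))
      fun z => by exact_mod_cast (basisNorm_pos p z).ne'
  have : Continuous fun x : (Fin (polyDim m n) → ℂ) × (Fin m → ℂ) =>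
      ‖∑ j, x.1 j * basisUnit p x.2 j‖ := by
    refine Continuous.norm (continuous_finsetSum _ fun j _ => ?_)
    exact ((continuous_apply j).comp continuous_fst).mul ((hu j).comp continuous_snd)
  exact Real.measurable_log.comp this.measurable

/-- The variance of an affine function of `Y` is bounded by the second moment of `Y`. -/
theorem variance_affine_le {Ω : Type*} [MeasurableSpace Ω] {μ : Measure Ω} [IsProbabilityMeasure μ]
    {X Y : Ω → ℝ} {r c : ℝ} (hY : MemLp Y 2 μ) (hX : X =ᵐ[μ] fun a => r * (Y a + c)) :
    variance μ X ≤ r ^ 2 * ∫ a, Y a ^ 2 ∂μ := by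
  have hi : Integrable Y μ := hY.integrable (by norm_num)
  have hi2 : Integrable (fun a => Y a ^ 2) μ := hY.integrable_sq
  have h1 : ∫ a, X a ∂μ = r * (∫ a, Y a ∂μ + c) := by
    rw [integral_congr_ae hX, integral_const_mul, integral_add hi (integrable_const c)]
    simp
  have h2 : ∫ a, X a ^ 2 ∂μ
      = r ^ 2 * (∫ a, Y a ^ 2 ∂μ + 2 * c * ∫ a, Y a ∂μ + c ^ 2) := by
    have : ∀ᵐ a ∂μ, X a ^ 2 = r ^ 2 * (Y a ^ 2 + 2 * c * Y a + c ^ 2) := by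
      filter_upwards [hX] with a ha
      rw [ha]
      ring
    have hs : Integrable (fun a => Y a ^ 2 + 2 * c * Y a) μ := hi2.add (hi.const_mul _)
    rw [integral_congr_ae this, integral_const_mul, integral_add hs (integrable_const _),
      integral_add hi2 (hi.const_mul _), integral_const_mul]
    simp
  rw [variance, h1, h2]
  nlinarith [mul_nonneg (sq_nonneg r) (sq_nonneg (∫ a, Y a ∂μ))]

/-- The variance bound for a single degree.  Almost surely, `⟨[Z_f], φ⟩` is
`∫ log |⟨a, v(z)⟩| G(z) dz` plus a constant, where `v(z)` is the unit vector of the values of the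
basis at `z`. -/
theorem exists_memLp_and_variance_le {m : ℕ} (hm : 1 ≤ m) (φ : TestForm m) :
    ∃ C : ℝ, 0 ≤ C ∧ ∀ {n : ℕ}, 1 ≤ n →
      ∀ (p : Module.Basis (Fin (polyDim m n)) ℂ (polySpace m n))
        (μ : Measure (Fin (polyDim m n) → ℂ)) [IsProbabilityMeasure μ] {α D : ℝ},
        (∀ F : Set (Fin (polyDim m n) → ℂ), IsPluripolar F → μ F = 0) → 2 ≤ α → 0 < D →
        LogMomentBound μ α D →
        MemLp (normalizedZeroCurrent p φ) 2 μ ∧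
          variance μ (normalizedZeroCurrent p φ) ≤ C ^ 2 * D ^ (2 / α) * (1 / (n : ℝ) ^ 2) := by
  obtain ⟨ι, _, ⟨k₀⟩, L, h, G, hh, hhc, hG, hGc, hPL⟩ := exists_zeroCurrent_eq hm φ
  refine ⟨∫ z, ‖G z‖, integral_nonneg fun _ => norm_nonneg _, ?_⟩
  intro n hn p μ _ α D hpp hα hD hmom
  have hGi : Integrable G := hG.integrable_of_hasCompactSupport hGc
  set ℓ : (Fin (polyDim m n) → ℂ) → (Fin m → ℂ) → ℝ :=
    fun a z => Real.log ‖∑ j, a j * basisUnit p z j‖ with hℓ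
  have hℓm : Measurable (Function.uncurry ℓ) := measurable_log_norm_sum_basisUnit p
  have hbd : ∀ z, ∫⁻ a, ‖ℓ a z‖ₑ ^ (2 : ℝ) ∂μ ≤ ENNReal.ofReal (D ^ (2 / α)) := fun z =>
    hmom.lintegral_sq_le hα hD (sum_norm_sq_basisUnit p z)
  have hlogN : ∀ g : (Fin m → ℂ) → ℝ, Continuous g → HasCompactSupport g →
      Integrable fun z => Real.log (basisNorm p z) * g z := fun g hg hgc =>
    (((continuous_basisNorm p).log fun z => (basisNorm_pos p z).ne').mul
      hg).integrable_of_hasCompactSupport hgc.mul_left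
  obtain ⟨hiG, hYm, hY2⟩ := lintegral_sq_integral_mul_le (μ := μ) (lam := volume) hℓm
    hG.measurable hGi ENNReal.ofReal_ne_top hbd
  set Y : (Fin (polyDim m n) → ℂ) → ℝ := fun a => ∫ z, ℓ a z * G z with hY
  -- the random variable is almost surely an affine function of `Y`
  have hX : normalizedZeroCurrent p φ =ᵐ[μ] fun a =>
      (1 / (n : ℝ)) * (Y a + ∫ z, Real.log (basisNorm p z) * G z) := by
    have hsep : ∀ᵐ a ∂μ, ∀ k,
        ∀ᵐ y, (linePoly (polyOf p a) (L k (1, 0)) (L k (0, y))).Separable := by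
      rw [ae_all_iff]
      intro k
      obtain ⟨P, hP, hPsep⟩ := exists_generic_separable hn p (u := L k (1, 0)) (by simp)
        ((L k : (ℂ × (Fin (m - 1) → ℂ)) →ₗ[ℂ] (Fin m → ℂ)).comp
          (LinearMap.inr ℂ ℂ (Fin (m - 1) → ℂ)))
      have hnull : ∀ᵐ a ∂μ, MvPolynomial.eval a P ≠ 0 := by
        rw [ae_iff]
        simp only [not_not]
        exact hpp _ (isPluripolar_zeroLocus hP)
      filter_upwards [hnull] with a ha
      exact hPsep a ha
    have hik : ∀ᵐ a ∂μ, ∀ k, Integrable fun z => ℓ a z * h k z := by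
      rw [ae_all_iff]
      intro k
      exact (lintegral_sq_integral_mul_le (μ := μ) (lam := volume) hℓm (hh k).measurable
        ((hh k).integrable_of_hasCompactSupport (hhc k)) ENNReal.ofReal_ne_top hbd).1
    filter_upwards [hsep, hik, hiG] with a ha hia hiaG
    have hf0 : polyOf p a ≠ 0 := by
      obtain ⟨y, hy⟩ := (ha k₀).exists
      intro h0
      apply hy.ne_zero
      rw [h0]
      simp [linePoly]
    have hlog : ∀ᵐ z, Real.log ‖MvPolynomial.eval z (polyOf p a)‖
        = ℓ a z + Real.log (basisNorm p z) := by
      filter_upwards [ae_eval_ne_zero hf0] with z hz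
      exact log_norm_eval_polyOf p hz
    have hmul : ∀ g : (Fin m → ℂ) → ℝ,
        (fun z => Real.log ‖MvPolynomial.eval z (polyOf p a)‖ * g z) =ᵐ[volume]
          fun z => ℓ a z * g z + Real.log (basisNorm p z) * g z := by
      intro g
      filter_upwards [hlog] with z hz
      rw [hz, add_mul]
    have hcur := hPL (polyOf p a) ha fun k =>
      ((hia k).add (hlogN (h k) (hh k) (hhc k))).congr (hmul (h k)).symm
    rw [normalizedZeroCurrent, hcur, integral_congr_ae (hmul G),
      integral_add hiaG (hlogN G hG hGc)]
  have hA : ∫⁻ z, ‖G z‖ₑ = ENNReal.ofReal (∫ z, ‖G z‖) :=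
    (ofReal_integral_norm_eq_lintegral_enorm hGi).symm
  have hC0 : 0 ≤ ∫ z, ‖G z‖ := integral_nonneg fun _ => norm_nonneg _
  have hD0 : 0 ≤ D ^ (2 / α) := Real.rpow_nonneg hD.le _
  have hY2' : ∫⁻ a, ‖Y a‖ₑ ^ (2 : ℝ) ∂μ
      ≤ ENNReal.ofReal ((∫ z, ‖G z‖) ^ 2 * D ^ (2 / α)) := by
    refine hY2.trans_eq ?_
    rw [hA, ENNReal.rpow_two, ← ENNReal.ofReal_pow hC0, ← ENNReal.ofReal_mul (by positivity)]
  have hYL : MemLp Y 2 μ := by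
    refine ⟨hYm, ?_⟩
    rw [eLpNorm_lt_top_iff_lintegral_rpow_enorm_lt_top (by norm_num) (by norm_num)]
    exact hY2'.trans_lt ENNReal.ofReal_lt_top
  have hEY : ∫ a, Y a ^ 2 ∂μ ≤ (∫ z, ‖G z‖) ^ 2 * D ^ (2 / α) := by
    rw [integral_eq_lintegral_of_nonneg_ae (Filter.Eventually.of_forall fun a => sq_nonneg _)
      hYL.integrable_sq.1]
    refine ENNReal.toReal_le_of_le_ofReal (by positivity) (le_trans (le_of_eq ?_) hY2')
    refine lintegral_congr fun a => ?_
    rw [ENNReal.rpow_two, ← ofReal_norm, ← ENNReal.ofReal_pow (norm_nonneg _), Real.norm_eq_abs,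
      sq_abs]
  refine ⟨?_, (variance_affine_le hYL hX).trans ?_⟩
  · exact ((hYL.add (memLp_const _)).const_mul _).ae_eq hX.symm
  · have hn2 : (0 : ℝ) ≤ (1 / (n : ℝ)) ^ 2 := by positivity
    calc (1 / (n : ℝ)) ^ 2 * ∫ a, Y a ^ 2 ∂μ
        ≤ (1 / (n : ℝ)) ^ 2 * ((∫ z, ‖G z‖) ^ 2 * D ^ (2 / α)) :=
          mul_le_mul_of_nonneg_left hEY hn2
      _ = (∫ z, ‖G z‖) ^ 2 * D ^ (2 / α) * (1 / (n : ℝ) ^ 2) := by ring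

end RandomZeros


open RandomZeros in
theorem theorem4 (m : ℕ) (hm : 1 ≤ m) (φ : TestForm m) :
    ∃ C : ℝ, 0 ≤ C ∧
      ∀ (K : Set (Fin m → ℂ)) (q : (Fin m → ℂ) → ℝ)
        (p : ∀ n : ℕ, Module.Basis (Fin (polyDim m n)) ℂ (polySpace m n))
        (μ : ∀ n : ℕ, MeasureTheory.Measure (Fin (polyDim m n) → ℂ))
        (α : ℝ) (D : ℕ → ℝ),
        IsCompact K → IsLocallyRegular K → ContinuousOn q K →
        (∀ n : ℕ, 1 ≤ n → ∀ j, ∀ z ∈ K,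
          ‖MvPolynomial.eval z (p n j : MvPolynomial (Fin m) ℂ)‖ * Real.exp (-(n * q z)) ≤ 1) →
        (∀ n : ℕ, 1 ≤ n → MeasureTheory.IsProbabilityMeasure (μ n)) →
        (∀ n : ℕ, 1 ≤ n → ∀ F : Set (Fin (polyDim m n) → ℂ), IsPluripolar F → μ n F = 0) →
        2 ≤ α →
        (∀ n : ℕ, 1 ≤ n → 0 < D n) →
        Asymptotics.IsLittleO Filter.atTop D (fun n : ℕ => (n : ℝ) ^ α) →
        (∀ n : ℕ, 1 ≤ n → LogMomentBound (μ n) α (D n)) →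
        ∀ n : ℕ, 1 ≤ n →
          MeasureTheory.MemLp (normalizedZeroCurrent (p n) φ) 2 (μ n) ∧
          variance (μ n) (normalizedZeroCurrent (p n) φ)
            ≤ C ^ 2 * D n ^ (2 / α) * (1 / (n : ℝ) ^ 2) := by
  obtain ⟨C, hC, hφ⟩ := exists_memLp_and_variance_le hm φ
  refine ⟨C, hC, fun K q p μ α D _ _ _ _ hprob hpp hα hD _ hmom n hn => ?_⟩
  have := hprob n hn
  exact hφ hn (p n) (μ n) (hpp n hn) hα (hD n hn) (hmom n hn)
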